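/- Let $\mathcal M,\mathcal N$ be model categories in Quillen's sense: categories with finite limits and colimits and a model structure, i.e. classes of fibrations, cofibrations and weak equivalences satisfying the lifting, factorization, retract and 2-out-of-3 axioms. An object $U$ of $\mathcal M$ is discrete homotopically subterminal if it is fibrant, its diagonal $U\to U\times U$ is a weak equivalence, and $U\to 1$ is a monomorphism. A model filter on $\mathcal M$ is a class $\Phi$ of such objects which is a filter for the order $U\le V\iff\mathrm{Hom}(U,V)\ne\emptyset$ (non-empty, upward closed among discrete homotopically subterminal objects, any two members have a common lower bound in $\Phi$), such that $f\times U$ is a cofibration (resp. weak equivalence) whenever $f$ is one and $U\in\Phi$. The filter quotient $\mathcal M_\Phi$ has the objects of $\mathcal M$; a morphism $X\to Y$ in it is a class of morphisms $f\colon X\times U\to Y$ of $\mathcal M$ with $U\in\Phi$, where $f\colon X\times U\to Y$ and $g\colon X\times V\to Y$ are identified if they agree on $X\times W$ for some $W\in\Phi$ with $W\le U,V$. Let $P_\Phi\colon\mathcal M\to\mathcal M_\Phi$ be the projection functor. A morphism of $\mathcal M_\Phi$ is called a fibration (cofibration, weak equivalence) if it has a representative $f\colon X\times U\to Y$ with $U\in\Phi$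 for which $(f,\mathrm{pr}_U)\colon X\times U\to Y\times U$ is a fibration (cofibration, weak equivalence) of $\mathcal M$. An adjunction $F\dashv G$ is a Quillen adjunction if $F$ preserves cofibrations and trivial cofibrations. A Quillen adjunction is a homotopical localization if its derived counit is an equivalence (for fibrant $Y$, cofibrant $Q$ and a weak equivalence $Q\to GY$, the composite $FQ\to FGY\to Y$ is a weak equivalence), a homotopical colocalization if its derived unit is an equivalence (for cofibrant $X$, fibrant $R$ and a weak equivalence $FX\to R$, the composite $X\to GFX\to GR$ is a weak equivalence), and a Quillen equivalence if, for cofibrant $X$ and fibrant $Y$, a morphism $FX\to Y$ is a weak equivalence if and only if its adjunct $X\to GY$ is one. Proposition. Let $\Phi_{\mathcal M}$, $\Phi_{\mathcal N}$ be model filters on $\mathcal M$, $\mathcal N$, and let $F\colon\mathcal M\rightleftarrows\mathcal N\colon G$ be a Quillen adjunction $F\dashv G$ such that for all $X\in\mathcal M$, $U\in\Phi_{\mathcal M}$ and $V\in\Phi_{\mathcal N}$ the canonical morphism $F(X\times U)\to F(X)\times F(U)$ is an isomorphism, $F(U)\in\Phi_{\mathcal N}$ and $G(V)\in\Phi_{\mathcal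 M}$. Then the above classes are model structures on $\mathcal M_{\Phi_{\mathcal M}}$ and $\mathcal N_{\Phi_{\mathcal N}}$, and the functors $\mathcal M_{\Phi_{\mathcal M}}\rightleftarrows\mathcal N_{\Phi_{\mathcal N}}$ induced by $F$ and $G$ (given by $F$ and $G$ on objects, and sending the class of $f\colon X\times U\to Y$ to the class of $F(X)\times F(U)\cong F(X\times U)\to F(Y)$, respectively likewise for $G$) form a Quillen adjunction, whose unit and counit are the images under $P_{\Phi_{\mathcal M}}$ and $P_{\Phi_{\mathcal N}}$ of those of $F\dashv G$. Moreover, if $F\dashv G$ is a homotopical localization (resp. a homotopical colocalization, a Quillen equivalence), then so is the induced adjunction. -/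

import Mathlib

open CategoryTheory Limits HomotopicalAlgebra

universe v u v₁ u₁ v₂ u₂

noncomputable section

namespace FilterQuotients

/-! ### Filter quotients of categories with finite products -/

section Quotient

variable {C : Type u} [Category.{v} C]

/-- What the construction of a filter quotient uses of a filter of subterminal objects: a nonempty
class of subterminal objects in which any two members have a common lower bound. -/
class IsDirectedSubterminal (Φ : ObjectProperty C) : Prop where
  isSubterminal : ∀ {U : C}, Φ U → IsSubterminal U
  nonempty : ∃ U : C, Φ U
  directed : ∀ {U V : C}, Φ U → Φ V → ∃ W : C, Φ W ∧ Nonempty (W ⟶ U) ∧ Nonempty (W ⟶ V)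

variable [HasFiniteProducts C]

/-- The composite `X ⨯ W ⟶ Y ⨯ V ⟶ Z` of `f : X ⨯ U ⟶ Y` and `g : Y ⨯ V ⟶ Z`, for
`W ≤ U, V`. -/
def compHom {X Y Z U V W : C} (f : X ⨯ U ⟶ Y) (g : Y ⨯ V ⟶ Z) (a : W ⟶ U) (b : W ⟶ V) :
    X ⨯ W ⟶ Z :=
  prod.lift (prod.map (𝟙 X) a ≫ f) (prod.snd ≫ b) ≫ g

lemma fst_compHom {X Z U V W : C} (g : X ⨯ V ⟶ Z) (a : W ⟶ U) (b : W ⟶ V) :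
    compHom prod.fst g a b = prod.map (𝟙 X) b ≫ g := by
  have : prod.lift (prod.map (𝟙 X) a ≫ prod.fst) (prod.snd ≫ b) = prod.map (𝟙 X) b := by
    ext <;> simp [prod.lift_fst, prod.lift_snd]
  rw [compHom, this]

lemma compHom_fst {X Y U V W : C} (f : X ⨯ U ⟶ Y) (a : W ⟶ U) (b : W ⟶ V) :
    compHom f prod.fst a b = prod.map (𝟙 X) a ≫ f := by
  simp [compHom, prod.lift_fst]

lemma compHom_assoc {X Y Z T U V A S : C} (f : X ⨯ U ⟶ Y) (g : Y ⨯ V ⟶ Z) (h : Z ⨯ A ⟶ T)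
    (a : S ⟶ U) (b : S ⟶ V) (d : S ⟶ A) :
    compHom (compHom f g a b) h (𝟙 S) d = compHom f (compHom g h b d) a (𝟙 S) := by
  have : prod.lift (compHom f g a b) (prod.snd ≫ d) =
      prod.lift (prod.map (𝟙 X) a ≫ f) prod.snd ≫
        prod.lift (prod.map (𝟙 Y) b ≫ g) (prod.snd ≫ d) := by
    ext <;> simp [compHom, prod.lift_fst, prod.lift_snd,
      prod.lift_snd_assoc]
  have h2 : compHom (compHom f g a b) h (𝟙 S) d =
      prod.lift (compHom f g a b) (prod.snd ≫ d) ≫ h := by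
    simp [compHom]
  rw [h2, this]
  simp only [compHom, Category.comp_id, Category.assoc]

lemma compHom_proj {X Y Z W : C} (f : X ⟶ Y) (g : Y ⟶ Z) :
    compHom (U := W) (V := W) (prod.fst ≫ f) (prod.fst ≫ g) (𝟙 W) (𝟙 W) =
      prod.fst ≫ f ≫ g := by
  simp [compHom, prod.lift_fst_assoc]

lemma compHom_congr {X Y Z U U' V V' W : C} {f : X ⨯ U ⟶ Y} {f' : X ⨯ U' ⟶ Y}
    {g : Y ⨯ V ⟶ Z} {g' : Y ⨯ V' ⟶ Z} {a : W ⟶ U} {a' : W ⟶ U'} {b : W ⟶ V} {b' : W ⟶ V'}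
    (h : prod.map (𝟙 X) a ≫ f = prod.map (𝟙 X) a' ≫ f')
    (k : prod.map (𝟙 Y) b ≫ g = prod.map (𝟙 Y) b' ≫ g') :
    compHom f g a b = compHom f' g' a' b' := by
  have e : ∀ {V : C} (r : X ⨯ W ⟶ Y) (b : W ⟶ V), prod.lift r (prod.snd ≫ b) =
      prod.lift r prod.snd ≫ prod.map (𝟙 Y) b := by
    intro V r b
    ext <;> simp [prod.lift_fst, prod.lift_snd]
  rw [compHom, compHom, e, e, Category.assoc, Category.assoc, k, h]

lemma map_compHom {X Y Z U V W R : C} (f : X ⨯ U ⟶ Y) (g : Y ⨯ V ⟶ Z) (a : W ⟶ U) (b : W ⟶ V)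
    (m : R ⟶ W) :
    prod.map (𝟙 X) m ≫ compHom f g a b = compHom f g (m ≫ a) (m ≫ b) := by
  rw [compHom, compHom, ← Category.assoc]
  congr 1
  ext <;> simp [prod.lift_fst, prod.lift_snd]

lemma fst_lift_initial [HasInitial C] {U : C} (hU : IsSubterminal U) :
    (prod.fst : (⊥_ C) ⨯ U ⟶ ⊥_ C) ≫ prod.lift (𝟙 _) (initial.to U) = 𝟙 _ := by
  ext
  · simp [prod.lift_fst]
  · exact hU _ _

lemma eq_of_prod_initial [HasInitial C] {U X : C} (hU : IsSubterminal U)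
    (f g : (⊥_ C) ⨯ U ⟶ X) : f = g := by
  rw [← Category.id_comp f, ← Category.id_comp g, ← fst_lift_initial hU, Category.assoc,
    Category.assoc]
  congr 1
  exact Subsingleton.elim _ _

variable (Φ : ObjectProperty C)

/-- A representative `X ⨯ U ⟶ Y`, with `U` in `Φ`, of a morphism of the filter quotient. -/
structure Rep (X Y : C) where
  U : C
  mem : Φ U
  hom : X ⨯ U ⟶ Y

variable {Φ}

/-- Two representatives `X ⨯ U ⟶ Y` and `X ⨯ V ⟶ Y` are equivalent if they agree on `X ⨯ W`
for some `W ≤ U, V` in `Φ`. -/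
def Rep.Rel {X Y : C} (f g : Rep Φ X Y) : Prop :=
  ∃ (W : C) (_ : Φ W) (a : W ⟶ f.U) (b : W ⟶ g.U),
    prod.map (𝟙 X) a ≫ f.hom = prod.map (𝟙 X) b ≫ g.hom

variable [IsDirectedSubterminal Φ]

lemma Rep.rel_equivalence (X Y : C) : Equivalence (Rep.Rel (Φ := Φ) (X := X) (Y := Y)) where
  refl f := ⟨f.U, f.mem, 𝟙 _, 𝟙 _, rfl⟩
  symm := by
    rintro f g ⟨W, hW, a, b, h⟩
    exact ⟨W, hW, b, a, h.symm⟩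
  trans := by
    rintro f g k ⟨W, hW, a, b, h⟩ ⟨W', hW', a', b', h'⟩
    obtain ⟨T, hT, ⟨c⟩, ⟨c'⟩⟩ := IsDirectedSubterminal.directed hW hW'
    refine ⟨T, hT, c ≫ a, c' ≫ b', ?_⟩
    have e : c ≫ b = c' ≫ a' := IsDirectedSubterminal.isSubterminal g.mem _ _
    have h1 := congrArg (fun t ↦ prod.map (𝟙 X) c ≫ t) h
    have h2 := congrArg (fun t ↦ prod.map (𝟙 X) c' ≫ t) h'
    simp only [prod.map_map_assoc, Category.comp_id] at h1 h2
    rw [h1, e, h2]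

instance Rep.setoid (X Y : C) : Setoid (Rep Φ X Y) := ⟨Rep.Rel, Rep.rel_equivalence X Y⟩

/-- The composite of two representatives on any common lower bound `W` of their domains. -/
def Rep.compOn {X Y Z : C} (f : Rep Φ X Y) (g : Rep Φ Y Z) {W : C} (hW : Φ W)
    (a : W ⟶ f.U) (b : W ⟶ g.U) : Rep Φ X Z :=
  ⟨W, hW, compHom f.hom g.hom a b⟩

lemma Rep.compOn_rel {X Y Z : C} {f f' : Rep Φ X Y} {g g' : Rep Φ Y Z}
    (hf : f.Rel f') (hg : g.Rel g') {W W' : C} (hW : Φ W) (hW' : Φ W')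
    (a : W ⟶ f.U) (b : W ⟶ g.U) (a' : W' ⟶ f'.U) (b' : W' ⟶ g'.U) :
    (f.compOn g hW a b).Rel (f'.compOn g' hW' a' b') := by
  obtain ⟨S, hS, p, p', h⟩ := hf
  obtain ⟨T, hT, q, q', k⟩ := hg
  obtain ⟨A, hA, ⟨x⟩, ⟨y⟩⟩ := IsDirectedSubterminal.directed hW hW'
  obtain ⟨B, hB, ⟨s⟩, ⟨t⟩⟩ := IsDirectedSubterminal.directed hS hT
  obtain ⟨R, hR, ⟨m⟩, ⟨n⟩⟩ := IsDirectedSubterminal.directed hA hB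
  refine ⟨R, hR, m ≫ x, m ≫ y, ?_⟩
  have e1 : (m ≫ x) ≫ a = (n ≫ s) ≫ p := IsDirectedSubterminal.isSubterminal f.mem _ _
  have e2 : (m ≫ y) ≫ a' = (n ≫ s) ≫ p' := IsDirectedSubterminal.isSubterminal f'.mem _ _
  have e3 : (m ≫ x) ≫ b = (n ≫ t) ≫ q := IsDirectedSubterminal.isSubterminal g.mem _ _
  have e4 : (m ≫ y) ≫ b' = (n ≫ t) ≫ q' := IsDirectedSubterminal.isSubterminal g'.mem _ _
  have h1 : prod.map (𝟙 X) ((m ≫ x) ≫ a) ≫ f.hom = prod.map (𝟙 X) ((m ≫ y) ≫ a') ≫ f'.hom := by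
    rw [e1, e2]
    have := congrArg (fun r ↦ prod.map (𝟙 X) (n ≫ s) ≫ r) h
    simpa only [prod.map_map_assoc, Category.comp_id] using this
  have h2 : prod.map (𝟙 Y) ((m ≫ x) ≫ b) ≫ g.hom = prod.map (𝟙 Y) ((m ≫ y) ≫ b') ≫ g'.hom := by
    rw [e3, e4]
    have := congrArg (fun r ↦ prod.map (𝟙 Y) (n ≫ t) ≫ r) k
    simpa only [prod.map_map_assoc, Category.comp_id] using this
  exact (map_compHom f.hom g.hom a b (m ≫ x)).trans
    ((compHom_congr h1 h2).trans (map_compHom f'.hom g'.hom a' b' (m ≫ y)).symm)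

/-- The composite of two representatives. The choice of the lower bound is immaterial, by
`Rep.compOn_rel`. -/
def Rep.comp {X Y Z : C} (f : Rep Φ X Y) (g : Rep Φ Y Z) : Rep Φ X Z :=
  have h := IsDirectedSubterminal.directed f.mem g.mem
  f.compOn g h.choose_spec.1 h.choose_spec.2.1.some h.choose_spec.2.2.some

lemma Rep.comp_rel {X Y Z : C} (f : Rep Φ X Y) (g : Rep Φ Y Z) {W : C} (hW : Φ W)
    (a : W ⟶ f.U) (b : W ⟶ g.U) : (f.comp g).Rel (f.compOn g hW a b) :=
  Rep.compOn_rel ((Rep.rel_equivalence _ _).refl f) ((Rep.rel_equivalence _ _).refl g) _ _ _ _ _ _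

/-- The filter quotient `C_Φ`: its objects are those of `C`. -/
@[ext]
structure FilterQuotient {C : Type u} [Category.{v} C] (Φ : ObjectProperty C) where
  obj : C

namespace FilterQuotient

/-- The class of `f : X ⨯ U ⟶ Y` as a morphism `X ⟶ Y` of the filter quotient. -/
def homMk {X Y U : C} (hU : Φ U) (f : X ⨯ U ⟶ Y) : Quotient (Rep.setoid (Φ := Φ) X Y) :=
  Quotient.mk _ ⟨U, hU, f⟩

instance : Category (FilterQuotient Φ) where
  Hom X Y := Quotient (Rep.setoid (Φ := Φ) X.obj Y.obj)
  id X := homMk (IsDirectedSubterminal.nonempty (Φ := Φ)).choose_spec prod.fst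
  comp := Quotient.map₂ Rep.comp
    (fun _ _ hf _ _ hg ↦ Rep.compOn_rel hf hg _ _ _ _ _ _)
  id_comp := by
    rintro X Y ⟨f⟩
    refine Quotient.sound ?_
    obtain ⟨W, hW, ⟨a⟩, ⟨b⟩⟩ := IsDirectedSubterminal.directed
      (IsDirectedSubterminal.nonempty (Φ := Φ)).choose_spec f.mem
    refine (Rep.rel_equivalence _ _).trans (Rep.comp_rel _ _ hW a b) ⟨W, hW, 𝟙 _, b, ?_⟩
    refine (map_compHom _ _ a b (𝟙 W)).trans ?_
    rw [Category.id_comp, Category.id_comp]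
    exact fst_compHom _ _ _
  comp_id := by
    rintro X Y ⟨f⟩
    refine Quotient.sound ?_
    obtain ⟨W, hW, ⟨a⟩, ⟨b⟩⟩ := IsDirectedSubterminal.directed f.mem
      (IsDirectedSubterminal.nonempty (Φ := Φ)).choose_spec
    refine (Rep.rel_equivalence _ _).trans (Rep.comp_rel _ _ hW a b) ⟨W, hW, 𝟙 _, a, ?_⟩
    refine (map_compHom _ _ a b (𝟙 W)).trans ?_
    rw [Category.id_comp, Category.id_comp]
    exact compHom_fst _ _ _
  assoc := by
    rintro X Y Z T ⟨f⟩ ⟨g⟩ ⟨h⟩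
    refine Quotient.sound ?_
    obtain ⟨W, hW, ⟨a⟩, ⟨b⟩⟩ := IsDirectedSubterminal.directed f.mem g.mem
    obtain ⟨S, hS, ⟨c⟩, ⟨d⟩⟩ := IsDirectedSubterminal.directed hW h.mem
    have eqv := Rep.rel_equivalence (Φ := Φ)
    have h1 : Rep.Rel ((f.comp g).comp h)
        ((f.compOn g hS (c ≫ a) (c ≫ b)).compOn h hS (𝟙 S) d) :=
      Rep.compOn_rel (Rep.comp_rel f g hS _ _) ((eqv _ _).refl h) _ _ _ _ _ _
    have h2 : Rep.Rel (f.comp (g.comp h))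
        (f.compOn (g.compOn h hS (c ≫ b) d) hS (c ≫ a) (𝟙 S)) :=
      Rep.compOn_rel ((eqv _ _).refl f) (Rep.comp_rel g h hS _ _) _ _ _ _ _ _
    refine (eqv _ _).trans h1 ((eqv _ _).trans ?_ ((eqv _ _).symm h2))
    refine ⟨S, hS, 𝟙 S, 𝟙 S, ?_⟩
    exact congrArg (fun r ↦ prod.map (𝟙 X.obj) (𝟙 S) ≫ r)
      (compHom_assoc f.hom g.hom h.hom (c ≫ a) (c ≫ b) d)

/-- The class of `f : X ⨯ U ⟶ Y` as a morphism of the filter quotient. -/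
def ofHom {X Y : FilterQuotient Φ} {U : C} (hU : Φ U) (f : X.obj ⨯ U ⟶ Y.obj) : X ⟶ Y :=
  homMk hU f

lemma ofHom_surjective {X Y : FilterQuotient Φ} (φ : X ⟶ Y) :
    ∃ (U : C) (hU : Φ U) (f : X.obj ⨯ U ⟶ Y.obj), φ = ofHom hU f := by
  obtain ⟨f, rfl⟩ := Quotient.exists_rep φ
  exact ⟨f.U, f.mem, f.hom, rfl⟩

lemma ofHom_eq_iff {X Y : FilterQuotient Φ} {U V : C} (hU : Φ U) (hV : Φ V)
    (f : X.obj ⨯ U ⟶ Y.obj) (g : X.obj ⨯ V ⟶ Y.obj) :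
    ofHom hU f = ofHom hV g ↔ ∃ (W : C) (_ : Φ W) (a : W ⟶ U) (b : W ⟶ V),
      prod.map (𝟙 X.obj) a ≫ f = prod.map (𝟙 X.obj) b ≫ g :=
  Quotient.eq (r := Rep.setoid (Φ := Φ) X.obj Y.obj)

lemma ofHom_comp {X Y Z : FilterQuotient Φ} {U V W : C} (hU : Φ U) (hV : Φ V) (hW : Φ W)
    (f : X.obj ⨯ U ⟶ Y.obj) (g : Y.obj ⨯ V ⟶ Z.obj) (a : W ⟶ U) (b : W ⟶ V) :
    ofHom hU f ≫ ofHom hV g =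
      ofHom hW (compHom f g a b) :=
  Quotient.sound (Rep.comp_rel (⟨U, hU, f⟩ : Rep Φ X.obj Y.obj) ⟨V, hV, g⟩ hW a b)

lemma id_eq {X : FilterQuotient Φ} {U : C} (hU : Φ U) :
    𝟙 X = ofHom hU (prod.fst : X.obj ⨯ U ⟶ X.obj) := by
  obtain ⟨W, hW, ⟨a⟩, ⟨b⟩⟩ := IsDirectedSubterminal.directed
      (IsDirectedSubterminal.nonempty (Φ := Φ)).choose_spec hU
  exact Quotient.sound ⟨W, hW, a, b, by simp⟩

variable (Φ) in
/-- The projection functor `P_Φ : C ⥤ C_Φ`: the identity on objects, it sends a morphism `f` to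
the class of `X ⨯ U ⟶ X ⟶ Y` (for any `U` in `Φ`; for `U` terminal this is the class of `f`). -/
def proj : C ⥤ FilterQuotient Φ where
  obj X := ⟨X⟩
  map f := ofHom (IsDirectedSubterminal.nonempty (Φ := Φ)).choose_spec (prod.fst ≫ f)
  map_id X := by rw [id_eq (IsDirectedSubterminal.nonempty (Φ := Φ)).choose_spec, Category.comp_id]
  map_comp {X Y Z} f g := by
    rw [ofHom_comp _ _ (IsDirectedSubterminal.nonempty (Φ := Φ)).choose_spec _ _ (𝟙 _) (𝟙 _)]
    exact congrArg _ (compHom_proj f g).symm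

lemma proj_map {X Y : C} (f : X ⟶ Y) {U : C} (hU : Φ U) :
    (proj Φ).map f = ofHom (X := ⟨X⟩) (Y := ⟨Y⟩) hU (prod.fst ≫ f) := by
  obtain ⟨W, hW, ⟨a⟩, ⟨b⟩⟩ := IsDirectedSubterminal.directed
      (IsDirectedSubterminal.nonempty (Φ := Φ)).choose_spec hU
  exact Quotient.sound ⟨W, hW, a, b, by simp⟩

instance : HasTerminal (FilterQuotient Φ) :=
  IsTerminal.hasTerminal (X := (⟨⊤_ C⟩ : FilterQuotient Φ)) <|
    IsTerminal.ofUniqueHom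
      (fun X ↦ (proj Φ).map (terminal.from X.obj)) (fun X φ ↦ by
        obtain ⟨U, hU, f, rfl⟩ := ofHom_surjective φ
        rw [proj_map _ hU]
        congr 1
        exact Subsingleton.elim _ _)

instance [HasInitial C] : HasInitial (FilterQuotient Φ) :=
  IsInitial.hasInitial (X := (⟨⊥_ C⟩ : FilterQuotient Φ)) <|
    IsInitial.ofUniqueHom
      (fun X ↦ (proj Φ).map (initial.to X.obj)) (fun X φ ↦ by
        obtain ⟨U, hU, f, rfl⟩ := ofHom_surjective φ
        rw [proj_map _ hU]
        exact congrArg (ofHom hU)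
          (eq_of_prod_initial (IsDirectedSubterminal.isSubterminal hU) f _))

end FilterQuotient

open FilterQuotient

/-- The class `S_Φ` of morphisms of the filter quotient, for a class `S` of morphisms of `C`:
those represented by some `f : X ⨯ U ⟶ Y` for which the morphism
`(f, pr₂) : X ⨯ U ⟶ Y ⨯ U` (that is, "`f × U`") is in `S`. -/
def quotientClass (S : MorphismProperty C) : MorphismProperty (FilterQuotient Φ) :=
  fun X Y φ ↦ ∃ (U : C) (hU : Φ U) (f : X.obj ⨯ U ⟶ Y.obj),
    φ = ofHom hU f ∧ S (prod.lift f prod.snd)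

end Quotient

/-! ### Functors between filter quotients -/

section Functors

open FilterQuotient

variable {C : Type u₁} [Category.{v₁} C] [HasFiniteProducts C]
  {D : Type u₂} [Category.{v₂} D] [HasFiniteProducts D]
  {Φ : ObjectProperty C} [IsDirectedSubterminal Φ] {Ψ : ObjectProperty D} [IsDirectedSubterminal Ψ]

/-- The morphism `F X ⨯ F U ≅ F (X ⨯ U) ⟶ F Y` attached to `f : X ⨯ U ⟶ Y`, if the canonical
morphism `F (X ⨯ U) ⟶ F X ⨯ F U` is invertible. -/
def mapRep (F : C ⥤ D) {X Y U : C} (h : IsIso (prodComparison F X U)) (f : X ⨯ U ⟶ Y) :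
    F.obj X ⨯ F.obj U ⟶ F.obj Y :=
  inv (prodComparison F X U) ≫ F.map f

lemma prodComparison_mapRep (F : C ⥤ D) {X Y U : C} (h : IsIso (prodComparison F X U))
    (f : X ⨯ U ⟶ Y) : prodComparison F X U ≫ mapRep F h f = F.map f := by
  simp [mapRep]

lemma map_mapRep (F : C ⥤ D) {X Y U W : C} (hU : IsIso (prodComparison F X U))
    (hW : IsIso (prodComparison F X W)) (a : W ⟶ U) (f : X ⨯ U ⟶ Y) :
    prod.map (𝟙 (F.obj X)) (F.map a) ≫ mapRep F hU f =
      mapRep F hW (prod.map (𝟙 X) a ≫ f) := by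
  rw [← cancel_epi (prodComparison F X W), prodComparison_mapRep]
  have e : prodComparison F X W ≫ prod.map (𝟙 (F.obj X)) (F.map a) =
      F.map (prod.map (𝟙 X) a) ≫ prodComparison F X U := by
    rw [prodComparison_natural, F.map_id]
  rw [reassoc_of% e, prodComparison_mapRep, F.map_comp]

lemma mapRep_compHom (F : C ⥤ D) {X Y Z U V W : C} (hU : IsIso (prodComparison F X U))
    (hV : IsIso (prodComparison F Y V)) (hW : IsIso (prodComparison F X W))
    (f : X ⨯ U ⟶ Y) (g : Y ⨯ V ⟶ Z) (a : W ⟶ U) (b : W ⟶ V) :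
    mapRep F hW (compHom f g a b) =
      compHom (mapRep F hU f) (mapRep F hV g) (F.map a) (F.map b) := by
  have e : F.map (prod.lift (prod.map (𝟙 X) a ≫ f) (prod.snd ≫ b)) ≫ prodComparison F Y V =
      prodComparison F X W ≫ prod.lift (mapRep F hW (prod.map (𝟙 X) a ≫ f))
        (prod.snd ≫ F.map b) := by
    ext
    · simp only [Category.assoc, prodComparison_fst, prod.lift_fst, prodComparison_mapRep,
        ← F.map_comp]
    · simp only [Category.assoc, prodComparison_snd, prod.lift_snd, prodComparison_snd_assoc,
        ← F.map_comp]
  rw [← cancel_epi (prodComparison F X W), prodComparison_mapRep, compHom, compHom, F.map_comp,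
    ← prodComparison_mapRep F hV g, reassoc_of% e, map_mapRep F hU hW]

/-- The functor between filter quotients induced by a functor `F` which sends `Φ` into `Ψ` and
satisfies `F (X ⨯ U) = F X ⨯ F U` (canonically) for all `X` and all `U` in `Φ`. It is `F` on
objects, and sends the class of `f : X ⨯ U ⟶ Y` to that of `F X ⨯ F U ≅ F (X ⨯ U) ⟶ F Y`. -/
def inducedFunctor (F : C ⥤ D) (hF : ∀ U : C, Φ U → Ψ (F.obj U))
    (hprod : ∀ X U : C, Φ U → IsIso (prodComparison F X U)) :
    FilterQuotient Φ ⥤ FilterQuotient Ψ where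
  obj X := ⟨F.obj X.obj⟩
  map {X Y} := Quotient.map
    (fun f ↦ ⟨F.obj f.U, hF _ f.mem, mapRep F (hprod X.obj f.U f.mem) f.hom⟩) (by
      rintro f g ⟨W, hW, a, b, h⟩
      refine ⟨F.obj W, hF _ hW, F.map a, F.map b, ?_⟩
      dsimp only
      rw [map_mapRep F _ (hprod X.obj W hW), map_mapRep F _ (hprod X.obj W hW), h])
  map_id X := by
    have hU := (IsDirectedSubterminal.nonempty (Φ := Φ)).choose_spec
    have e : ∀ {U : C} (hU : Φ U),
        mapRep F (hprod X.obj U hU) (prod.fst : X.obj ⨯ U ⟶ X.obj) = prod.fst := by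
      intro U hU
      have := hprod X.obj U hU
      rw [← cancel_epi (prodComparison F X.obj U), prodComparison_mapRep]
      simp
    refine Eq.trans ?_ (id_eq (X := (⟨F.obj X.obj⟩ : FilterQuotient Ψ)) (hF _ hU)).symm
    exact congrArg (ofHom (X := (⟨F.obj X.obj⟩ : FilterQuotient Ψ))
      (Y := (⟨F.obj X.obj⟩ : FilterQuotient Ψ)) (hF _ hU)) (e hU)
  map_comp {X Y Z} := by
    rintro ⟨f⟩ ⟨g⟩
    obtain ⟨W, hW, ⟨a⟩, ⟨b⟩⟩ := IsDirectedSubterminal.directed f.mem g.mem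
    have h1 : (Quotient.mk _ f : X ⟶ Y) ≫ (Quotient.mk _ g : Y ⟶ Z) =
        ofHom hW (compHom f.hom g.hom a b) :=
      ofHom_comp f.mem g.mem hW f.hom g.hom a b
    refine (congrArg _ h1).trans ?_
    refine Eq.trans ?_ (ofHom_comp (X := (⟨F.obj X.obj⟩ : FilterQuotient Ψ))
      (Y := (⟨F.obj Y.obj⟩ : FilterQuotient Ψ)) (Z := (⟨F.obj Z.obj⟩ : FilterQuotient Ψ))
      (hF _ f.mem) (hF _ g.mem) (hF _ hW)
      (mapRep F (hprod X.obj f.U f.mem) f.hom) (mapRep F (hprod Y.obj g.U g.mem) g.hom)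
      (F.map a) (F.map b)).symm
    refine congrArg (ofHom (X := (⟨F.obj X.obj⟩ : FilterQuotient Ψ))
      (Y := (⟨F.obj Z.obj⟩ : FilterQuotient Ψ)) (hF _ hW)) ?_
    exact mapRep_compHom F _ _ _ f.hom g.hom a b

lemma inducedFunctor_map_ofHom (F : C ⥤ D) (hF : ∀ U : C, Φ U → Ψ (F.obj U))
    (hprod : ∀ X U : C, Φ U → IsIso (prodComparison F X U)) {X Y : FilterQuotient Φ} {U : C}
    (hU : Φ U) (f : X.obj ⨯ U ⟶ Y.obj) :
    (inducedFunctor F hF hprod).map (ofHom hU f) =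
      ofHom (X := (⟨F.obj X.obj⟩ : FilterQuotient Ψ)) (Y := (⟨F.obj Y.obj⟩ : FilterQuotient Ψ))
        (hF _ hU) (mapRep F (hprod X.obj U hU) f) :=
  rfl

/-- A right adjoint commutes with products. -/
lemma isIso_prodComparison_of_adjunction {F : C ⥤ D} {G : D ⥤ C} (adj : F ⊣ G) (X U : D) :
    IsIso (prodComparison G X U) := by
  have : PreservesLimitsOfSize.{0, 0} G := adj.rightAdjoint_preservesLimits
  infer_instance

end Functors

/-! ### Model structures and model filters -/

section Model

/-- The axioms of a model structure (lifting, factorization, retracts, two-out-of-three) for the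
given classes of fibrations, cofibrations and weak equivalences of a category. -/
structure IsModelStructure (C : Type u) [Category.{v} C] [CategoryWithFibrations C]
    [CategoryWithCofibrations C] [CategoryWithWeakEquivalences C] : Prop where
  lifting_trivialCofibration : ∀ {A B X Y : C} (i : A ⟶ B) (p : X ⟶ Y),
    trivialCofibrations C i → fibrations C p → HasLiftingProperty i p
  lifting_trivialFibration : ∀ {A B X Y : C} (i : A ⟶ B) (p : X ⟶ Y),
    cofibrations C i → trivialFibrations C p → HasLiftingProperty i p
  factorization_trivialCofibration :
    MorphismProperty.HasFactorization (trivialCofibrations C) (fibrations C)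
  factorization_trivialFibration :
    MorphismProperty.HasFactorization (cofibrations C) (trivialFibrations C)
  retract_fibrations : (fibrations C).IsStableUnderRetracts
  retract_cofibrations : (cofibrations C).IsStableUnderRetracts
  retract_weakEquivalences : (weakEquivalences C).IsStableUnderRetracts
  two_out_of_three : (weakEquivalences C).HasTwoOutOfThreeProperty

variable {M : Type u} [Category.{v} M] [ModelCategory M]

/-- An object is homotopically subterminal if it is fibrant and its diagonal is a weak
equivalence. -/
def IsHomotopicallySubterminal (U : M) : Prop :=
  IsFibrant U ∧ WeakEquivalence (diag U)

/-- A homotopically subterminal object is discrete if it is also subterminal. -/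
def IsDiscreteHomotopicallySubterminal (U : M) : Prop :=
  IsHomotopicallySubterminal U ∧ IsSubterminal U

/-- A class of morphisms is `Φ`-product stable if it contains `f × U` whenever it contains `f`,
for `U` in `Φ`. -/
def IsProductStable (Φ : ObjectProperty M) (S : MorphismProperty M) : Prop :=
  ∀ ⦃X Y : M⦄ (f : X ⟶ Y) (U : M), Φ U → S f → S (prod.map f (𝟙 U))

/-- A model filter: a filter in the poset of discrete homotopically subterminal objects (ordered by
existence of a morphism) such that cofibrations and weak equivalences are `Φ`-product stable. -/
class IsModelFilter (Φ : ObjectProperty M) : Prop where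
  isDiscreteHomotopicallySubterminal : ∀ {U : M}, Φ U → IsDiscreteHomotopicallySubterminal U
  nonempty : ∃ U : M, Φ U
  upward_closed : ∀ {U V : M}, Φ U → IsDiscreteHomotopicallySubterminal V → Nonempty (U ⟶ V) → Φ V
  directed : ∀ {U V : M}, Φ U → Φ V → ∃ W : M, Φ W ∧ Nonempty (W ⟶ U) ∧ Nonempty (W ⟶ V)
  cofibrations_stable : IsProductStable Φ (cofibrations M)
  weakEquivalences_stable : IsProductStable Φ (weakEquivalences M)

instance (Φ : ObjectProperty M) [h : IsModelFilter Φ] : IsDirectedSubterminal Φ where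
  isSubterminal hU := (h.isDiscreteHomotopicallySubterminal hU).2
  nonempty := h.nonempty
  directed := h.directed

variable (Φ : ObjectProperty M) [IsModelFilter Φ]

instance : CategoryWithFibrations (FilterQuotient Φ) := ⟨quotientClass (fibrations M)⟩

instance : CategoryWithCofibrations (FilterQuotient Φ) := ⟨quotientClass (cofibrations M)⟩

instance : CategoryWithWeakEquivalences (FilterQuotient Φ) := ⟨quotientClass (weakEquivalences M)⟩

end Model

/-! ### Quillen adjunctions -/

section Quillen

variable {C : Type u₁} [Category.{v₁} C] [CategoryWithFibrations C]
  [CategoryWithCofibrations C] [CategoryWithWeakEquivalences C]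
  {D : Type u₂} [Category.{v₂} D] [CategoryWithFibrations D]
  [CategoryWithCofibrations D] [CategoryWithWeakEquivalences D]
  {F : C ⥤ D} {G : D ⥤ C}

/-- An adjunction is a Quillen adjunction if the left adjoint preserves cofibrations and trivial
cofibrations. -/
structure IsQuillenAdjunction (_adj : F ⊣ G) : Prop where
  cofibrations_map : ∀ {X Y : C} (f : X ⟶ Y), cofibrations C f → cofibrations D (F.map f)
  trivialCofibrations_map : ∀ {X Y : C} (f : X ⟶ Y),
    trivialCofibrations C f → trivialCofibrations D (F.map f)

/-- The derived unit is an equivalence: for cofibrant `X` and every fibrant replacement `F X ⟶ R`,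
the composite `X ⟶ G F X ⟶ G R` is a weak equivalence. -/
def DerivedUnitIsEquivalence [HasInitial C] [HasTerminal D] (adj : F ⊣ G) : Prop :=
  ∀ (X : C) (R : D) (j : F.obj X ⟶ R), IsCofibrant X → IsFibrant R → weakEquivalences D j →
    weakEquivalences C (adj.unit.app X ≫ G.map j)

/-- The derived counit is an equivalence: for fibrant `Y` and every cofibrant replacement
`Q ⟶ G Y`, the composite `F Q ⟶ F G Y ⟶ Y` is a weak equivalence. -/
def DerivedCounitIsEquivalence [HasInitial C] [HasTerminal D] (adj : F ⊣ G) : Prop :=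
  ∀ (Y : D) (Q : C) (q : Q ⟶ G.obj Y), IsFibrant Y → IsCofibrant Q → weakEquivalences C q →
    weakEquivalences D (F.map q ≫ adj.counit.app Y)

/-- A homotopical localization: a Quillen adjunction whose derived counit is an equivalence, that
is, whose right adjoint is homotopically fully faithful. -/
def IsHomotopicalLocalization [HasInitial C] [HasTerminal D] (adj : F ⊣ G) : Prop :=
  IsQuillenAdjunction adj ∧ DerivedCounitIsEquivalence adj

/-- A homotopical colocalization: a Quillen adjunction whose derived unit is an equivalence, that
is, whose left adjoint is homotopically fully faithful. -/
def IsHomotopicalColocalization [HasInitial C] [HasTerminal D] (adj : F ⊣ G) : Prop :=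
  IsQuillenAdjunction adj ∧ DerivedUnitIsEquivalence adj

/-- A Quillen equivalence: a Quillen adjunction such that, for cofibrant `X` and fibrant `Y`, a
morphism `F X ⟶ Y` is a weak equivalence if and only if its adjunct `X ⟶ G Y` is one. -/
def IsQuillenEquivalence [HasInitial C] [HasTerminal D] (adj : F ⊣ G) : Prop :=
  IsQuillenAdjunction adj ∧ ∀ (X : C) (Y : D) (f : F.obj X ⟶ Y), IsCofibrant X → IsFibrant Y →
    (weakEquivalences D f ↔ weakEquivalences C (adj.homEquiv X Y f))

end Quillen

end FilterQuotients

end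

open FilterQuotients

open FilterQuotients

noncomputable section

namespace FilterQuotients

open FilterQuotient

/-! ### Sufficiently small members of the filter -/

section Levels

variable {C : Type u} [Category.{v} C] {Φ : ObjectProperty C} [IsDirectedSubterminal Φ]

/-! A representative `f : X ⨯ U ⟶ Y` is the same thing as the morphism `level f : X ⨯ U ⟶ Y ⨯ U`
over `U`, and composing representatives on a common `U` is composing such morphisms. So the filter
quotient is a directed union of levels `U`, with restriction along `W ≤ U` as transition. Since `U`
is subterminal, restriction to `W` is, up to isomorphism, the product with `W`; hence a class stable
under products with members of `Φ` persists when the level shrinks (`StableUnderProd.restrict`). A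
finite diagram with finitely many equations is realised at a single small level, where the axioms of
the original model category apply. This gives lifting, retracts and two-out-of-three; factorization
needs only one level.

In the quotient the projection `X ⨯ U ⟶ X` is invertible (`isIso_proj_map_fst`), so each morphism
is, up to isomorphism, in the image of `proj`. Naturality can therefore be tested on that image,
where the induced functors act as `F` and `G`; the images of the old unit and counit then form an
adjunction. It is Quillen because `F` preserves the relevant classes level by level.

For the derived counit, a fibrant `Y` of the quotient is isomorphic to the image of some `Y ⨯ V`
fibrant in `N`. For a cofibrant replacement of `G (Y ⨯ V)` taken in `M`, the claim is the image of
the hypothesis. Any other cofibrant replacement maps to this one by a weak equivalence between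
cofibrant objects, which Ken Brown's lemma, applied at a small level, shows to be preserved by `F`.
The derived unit is dual, and a Quillen equivalence is the conjunction of both conditions. -/

lemma isSubterminal_of_mem {U : C} (hU : Φ U) : IsSubterminal U :=
  IsDirectedSubterminal.isSubterminal hU

variable (Φ) in
/-- The filter on the members of `Φ` generated by the sets of members below a given one. -/
def levels : Filter (Subtype Φ) where
  sets := {s | ∃ U : Subtype Φ, ∀ W : Subtype Φ, Nonempty (W.1 ⟶ U.1) → W ∈ s}
  univ_sets := ⟨⟨_, (IsDirectedSubterminal.nonempty (Φ := Φ)).choose_spec⟩, fun _ _ ↦ trivial⟩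
  sets_of_superset := by
    rintro s t ⟨U, h⟩ hst
    exact ⟨U, fun W hW ↦ hst (h W hW)⟩
  inter_sets := by
    rintro s t ⟨U, h⟩ ⟨V, k⟩
    obtain ⟨W, hW, ⟨a⟩, ⟨b⟩⟩ := IsDirectedSubterminal.directed U.2 V.2
    exact ⟨⟨W, hW⟩, fun T ⟨c⟩ ↦ ⟨h T ⟨c ≫ a⟩, k T ⟨c ≫ b⟩⟩⟩

lemma eventually_levels_iff {p : Subtype Φ → Prop} :
    (∀ᶠ W in levels Φ, p W) ↔
      ∃ U : Subtype Φ, ∀ W : Subtype Φ, Nonempty (W.1 ⟶ U.1) → p W := Iff.rfl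

/-- This is what allows an actual level to be extracted, by `.exists`, from any finite list of
properties that hold at all small levels. -/
instance : (levels Φ).NeBot := by
  refine ⟨fun h ↦ ?_⟩
  obtain ⟨U, hU⟩ := Filter.empty_mem_iff_bot.2 h
  exact hU U ⟨𝟙 _⟩

lemma eventually_nonempty_hom {U : C} (hU : Φ U) :
    ∀ᶠ W in levels Φ, Nonempty (W.1 ⟶ U) :=
  eventually_levels_iff.2 ⟨⟨U, hU⟩, fun _ h ↦ h⟩

end Levels

/-! ### Morphisms of the quotient as morphisms over a level -/

section Quotient

variable {C : Type u} [Category.{v} C] [HasFiniteProducts C]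

/-- The morphism `(f, pr₂) : X ⨯ U ⟶ Y ⨯ U` attached to `f : X ⨯ U ⟶ Y`. -/
def level {X Y U : C} (f : X ⨯ U ⟶ Y) : X ⨯ U ⟶ Y ⨯ U := prod.lift f prod.snd

lemma level_fst {X Y U : C} (f : X ⨯ U ⟶ Y) : level f ≫ prod.fst = f := prod.lift_fst _ _

lemma level_snd {X Y U : C} (f : X ⨯ U ⟶ Y) : level f ≫ prod.snd = prod.snd := prod.lift_snd _ _

lemma level_projection (X U : C) : level (prod.fst : X ⨯ U ⟶ X) = 𝟙 _ := by
  ext <;> simp [level_fst, level_snd]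

lemma level_comp {X Y Z U : C} (f : X ⨯ U ⟶ Y) (g : Y ⨯ U ⟶ Z) :
    level (level f ≫ g) = level f ≫ level g := by
  ext <;> simp only [level_fst, level_snd, Category.assoc]

/-- Morphisms over `U` are exactly the levels; this turns a lift found in `C` back into a
representative. -/
lemma eq_level {X Y U : C} (l : X ⨯ U ⟶ Y ⨯ U) (h : l ≫ prod.snd = prod.snd) :
    level (l ≫ prod.fst) = l := by
  ext
  · rw [level_fst]
  · rw [level_snd, h]

lemma compHom_self {X Y Z U : C} (f : X ⨯ U ⟶ Y) (g : Y ⨯ U ⟶ Z) :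
    compHom f g (𝟙 U) (𝟙 U) = level f ≫ g := by
  simp [compHom, level]

lemma restrict_level {X Y U W : C} (f : X ⨯ U ⟶ Y) (a : W ⟶ U) :
    prod.map (𝟙 X) a ≫ level f = level (prod.map (𝟙 X) a ≫ f) ≫ prod.map (𝟙 Y) a := by
  ext
  · simp [level, prod.lift_fst]
  · simp [level, prod.lift_snd]

lemma restrict_comp {X Y Z U W : C} (f : X ⨯ U ⟶ Y) (g : Y ⨯ U ⟶ Z) (a : W ⟶ U) :
    prod.map (𝟙 X) a ≫ level f ≫ g =
      level (prod.map (𝟙 X) a ≫ f) ≫ prod.map (𝟙 Y) a ≫ g := by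
  rw [← Category.assoc, restrict_level, Category.assoc]

/-- If `W ≤ U` and `U` is subterminal, then `X ⨯ W` is isomorphic to `(X ⨯ U) ⨯ W`. -/
@[simps]
def prodRestrictIso (X : C) {U W : C} (hU : IsSubterminal U) (a : W ⟶ U) :
    X ⨯ W ≅ (X ⨯ U) ⨯ W where
  hom := prod.lift (prod.map (𝟙 X) a) prod.snd
  inv := prod.map prod.fst (𝟙 W)
  hom_inv_id := by
    ext
    · simp
    · simp
  inv_hom_id := by
    ext
    · simp [prod.lift_fst_assoc]
    · exact hU _ _
    · simp [prod.lift_snd]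

lemma prodRestrictIso_hom_map_level {X Y U W : C} (hU : IsSubterminal U) (a : W ⟶ U)
    (f : X ⨯ U ⟶ Y) :
    (prodRestrictIso X hU a).hom ≫ prod.map (level f) (𝟙 W) =
      level (prod.map (𝟙 X) a ≫ f) ≫ (prodRestrictIso Y hU a).hom := by
  ext
  · simp [prod.lift_fst_assoc, level_fst]
  · exact hU _ _
  · simp [prod.lift_snd, level_snd]

/-- The class `S` contains `f ⨯ U` whenever it contains `f`, for `U` in `Φ`. -/
def StableUnderProd (Φ : ObjectProperty C) (S : MorphismProperty C) : Prop :=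
  ∀ ⦃X Y : C⦄ (f : X ⟶ Y) (U : C), Φ U → S f → S (prod.map f (𝟙 U))

lemma StableUnderProd.inf {Φ : ObjectProperty C} {S T : MorphismProperty C}
    (hS : StableUnderProd Φ S) (hT : StableUnderProd Φ T) : StableUnderProd Φ (S ⊓ T) :=
  fun _ _ f U hU hf ↦ ⟨hS f U hU hf.1, hT f U hU hf.2⟩

variable {Φ : ObjectProperty C} [IsDirectedSubterminal Φ]

/-- Through `X ⨯ W ≅ (X ⨯ U) ⨯ W`, valid because `U` is subterminal, the restricted level is
isomorphic as an arrow to `level f ⨯ W`. -/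
lemma StableUnderProd.restrict {S : MorphismProperty C} (hS : StableUnderProd Φ S) [S.RespectsIso]
    {X Y U W : C} (hU : Φ U) (hW : Φ W) (a : W ⟶ U) {f : X ⨯ U ⟶ Y} (hf : S (level f)) :
    S (level (prod.map (𝟙 X) a ≫ f)) :=
  (S.arrow_mk_iso_iff (Arrow.isoMk (prodRestrictIso X (isSubterminal_of_mem hU) a)
    (prodRestrictIso Y (isSubterminal_of_mem hU) a)
    (prodRestrictIso_hom_map_level (isSubterminal_of_mem hU) a f))).2 (hS _ W hW hf)

lemma eventually_exists_rep {X Y : FilterQuotient Φ} (φ : X ⟶ Y) :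
    ∀ᶠ W in levels Φ, ∃ f : X.obj ⨯ W.1 ⟶ Y.obj, φ = ofHom W.2 f := by
  obtain ⟨U, hU, f, rfl⟩ := ofHom_surjective φ
  filter_upwards [eventually_nonempty_hom hU] with W hW
  obtain ⟨a⟩ := hW
  exact ⟨prod.map (𝟙 _) a ≫ f, (ofHom_eq_iff _ _ _ _).2 ⟨W.1, W.2, a, 𝟙 _, by simp⟩⟩

lemma ofHom_restrict {X Y : FilterQuotient Φ} {U W : C} (hU : Φ U) (hW : Φ W)
    (f : X.obj ⨯ U ⟶ Y.obj) (a : W ⟶ U) :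
    ofHom (X := X) (Y := Y) hW (prod.map (𝟙 _) a ≫ f) = ofHom hU f :=
  (ofHom_eq_iff _ _ _ _).2 ⟨W, hW, 𝟙 _, a, by simp⟩

/-- Once two representatives agree on some `V`, they agree on everything below `V`. Quantifying over
all `a` costs nothing, since `U` is subterminal and `a` is unique. -/
lemma eventually_of_eq {X Y : FilterQuotient Φ} {U : C} (hU : Φ U)
    {f g : X.obj ⨯ U ⟶ Y.obj} (h : ofHom (X := X) (Y := Y) hU f = ofHom hU g) :
    ∀ᶠ W in levels Φ, ∀ a : W.1 ⟶ U,
      prod.map (𝟙 X.obj) a ≫ f = prod.map (𝟙 X.obj) a ≫ g := by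
  obtain ⟨V, hV, b, b', h⟩ := (ofHom_eq_iff _ _ _ _).1 h
  filter_upwards [eventually_nonempty_hom hV] with W hW a
  obtain ⟨c⟩ := hW
  obtain rfl := isSubterminal_of_mem hU b b'
  obtain rfl := isSubterminal_of_mem hU a (c ≫ b)
  have := congrArg (fun t ↦ prod.map (𝟙 X.obj) c ≫ t) h
  simpa only [prod.map_map_assoc, Category.comp_id] using this

lemma ofHom_comp_ofHom {X Y Z : FilterQuotient Φ} {U : C} (hU : Φ U)
    (f : X.obj ⨯ U ⟶ Y.obj) (g : Y.obj ⨯ U ⟶ Z.obj) :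
    ofHom (X := X) (Y := Y) hU f ≫ ofHom (X := Y) (Y := Z) hU g =
      ofHom (X := X) (Y := Z) hU (level f ≫ g) := by
  rw [ofHom_comp hU hU hU f g (𝟙 U) (𝟙 U), compHom_self]

/-! ### Closure properties inherited by the quotient classes -/

section Classes

variable {S T : MorphismProperty C}

/-- Frees membership from the choice of representative: a good representative agrees with the given
one on some smaller level, and goodness survives restriction. -/
lemma quotientClass_ofHom_iff (hS : StableUnderProd Φ S) [S.RespectsIso]
    {X Y : FilterQuotient Φ} {U : C} (hU : Φ U) (f : X.obj ⨯ U ⟶ Y.obj) :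
    quotientClass S (ofHom (X := X) (Y := Y) hU f) ↔
      ∀ᶠ W in levels Φ, ∀ a : W.1 ⟶ U, S (level (prod.map (𝟙 X.obj) a ≫ f)) := by
  constructor
  · rintro ⟨V, hV, g, h, hg⟩
    obtain ⟨T, hT, a, b, h⟩ := (ofHom_eq_iff _ _ _ _).1 h
    filter_upwards [eventually_nonempty_hom hT] with W hW c
    obtain ⟨d⟩ := hW
    obtain rfl := isSubterminal_of_mem hU c (d ≫ a)
    have := congrArg (fun t ↦ prod.map (𝟙 X.obj) d ≫ t) h
    simp only [prod.map_map_assoc, Category.comp_id] at this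
    rw [this]
    exact hS.restrict hV W.2 _ hg
  · intro h
    obtain ⟨W, hW, ⟨a⟩⟩ := (h.and (eventually_nonempty_hom hU)).exists
    exact ⟨W.1, W.2, _, (ofHom_restrict hU W.2 f a).symm, hW a⟩

lemma eventually_exists_rep_of_quotientClass (hS : StableUnderProd Φ S) [S.RespectsIso]
    {X Y : FilterQuotient Φ} {φ : X ⟶ Y} (hφ : quotientClass S φ) :
    ∀ᶠ W in levels Φ, ∃ f : X.obj ⨯ W.1 ⟶ Y.obj, φ = ofHom W.2 f ∧ S (level f) := by
  obtain ⟨U, hU, f, rfl, hf⟩ := hφ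
  filter_upwards [eventually_nonempty_hom hU] with W hW
  obtain ⟨a⟩ := hW
  exact ⟨prod.map (𝟙 _) a ≫ f, (ofHom_restrict hU W.2 f a).symm, hS.restrict hU W.2 a hf⟩

lemma quotientClass_ofHom {X Y : FilterQuotient Φ} {U : C} (hU : Φ U) {f : X.obj ⨯ U ⟶ Y.obj}
    (hf : S (level f)) : quotientClass S (ofHom (X := X) (Y := Y) hU f) :=
  ⟨U, hU, f, rfl, hf⟩

/-- The two memberships may be witnessed by different representatives; after shrinking, one
representative serves for both. This identifies trivial cofibrations and trivial fibrations of the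
quotient. -/
lemma quotientClass_inf (hS : StableUnderProd Φ S) (hT : StableUnderProd Φ T)
    [S.RespectsIso] [T.RespectsIso] :
    quotientClass (Φ := Φ) S ⊓ quotientClass T = quotientClass (S ⊓ T) := by
  ext X Y φ
  constructor
  · rintro ⟨h, k⟩
    obtain ⟨U, hU, f, rfl⟩ := ofHom_surjective φ
    have h' := (quotientClass_ofHom_iff hS hU f).1 h
    have k' := (quotientClass_ofHom_iff hT hU f).1 k
    obtain ⟨W, ⟨h, k⟩, ⟨a⟩⟩ := ((h'.and k').and (eventually_nonempty_hom hU)).exists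
    exact ⟨W.1, W.2, _, (ofHom_restrict hU W.2 f a).symm, h a, k a⟩
  · rintro ⟨U, hU, f, rfl, h, k⟩
    exact ⟨quotientClass_ofHom hU h, quotientClass_ofHom hU k⟩

lemma quotientClass_proj_map (hS : StableUnderProd Φ S) {X Y : C} {f : X ⟶ Y} (hf : S f) :
    quotientClass S ((proj Φ).map f) := by
  obtain ⟨U, hU⟩ := IsDirectedSubterminal.nonempty (Φ := Φ)
  have e : level (prod.fst ≫ f : X ⨯ U ⟶ Y) = prod.map f (𝟙 U) := by
    ext <;> simp [level_fst, level_snd]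
  have h : S (level (prod.fst ≫ f : X ⨯ U ⟶ Y)) := by
    rw [e]
    exact hS f U hU hf
  exact ⟨U, hU, prod.fst ≫ f, proj_map f hU, h⟩

lemma quotientClass_isStableUnderRetracts (hS : StableUnderProd Φ S) [S.IsStableUnderRetracts]
    [S.RespectsIso] : (quotientClass (Φ := Φ) S).IsStableUnderRetracts where
  of_retract {X Y Z T φ ψ} h hψ := by
    obtain ⟨il, ir, rl, rr, e1, e2, e3, e4⟩ : ∃ (il : X ⟶ Z) (ir : Y ⟶ T) (rl : Z ⟶ X)
        (rr : T ⟶ Y), il ≫ rl = 𝟙 X ∧ ir ≫ rr = 𝟙 Y ∧ il ≫ ψ = φ ≫ ir ∧ rl ≫ φ = ψ ≫ rr :=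
      ⟨h.i.left, h.i.right, h.r.left, h.r.right, h.retract_left, h.retract_right, h.i_w, h.r_w⟩
    -- All six morphisms of the retract diagram are represented on one `U`; the four equations hold
    -- only on a smaller `W`, chosen afterwards.
    obtain ⟨U, ⟨⟨⟨⟨⟨f, rfl⟩, g, rfl, hg⟩, i, rfl⟩, j, rfl⟩, r, rfl⟩, s, rfl⟩ :=
      ((((((eventually_exists_rep φ).and (eventually_exists_rep_of_quotientClass hS hψ)).and
      (eventually_exists_rep il)).and (eventually_exists_rep ir)).and
      (eventually_exists_rep rl)).and (eventually_exists_rep rr)).exists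
    rw [ofHom_comp_ofHom, FilterQuotient.id_eq U.2] at e1 e2
    rw [ofHom_comp_ofHom, ofHom_comp_ofHom] at e3 e4
    obtain ⟨W, ⟨⟨⟨⟨e1, e2⟩, e3⟩, e4⟩, ⟨a⟩⟩⟩ := (((((eventually_of_eq _ e1).and
      (eventually_of_eq _ e2)).and (eventually_of_eq _ e3)).and (eventually_of_eq _ e4)).and
      (eventually_nonempty_hom U.2)).exists
    replace e1 := congrArg level (e1 a)
    replace e2 := congrArg level (e2 a)
    replace e3 := congrArg level (e3 a)
    replace e4 := congrArg level (e4 a)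
    simp only [restrict_comp, level_comp, prod.map_fst, Category.comp_id, level_projection]
      at e1 e2 e3 e4
    rw [← ofHom_restrict U.2 W.2 f a]
    exact quotientClass_ofHom W.2 (MorphismProperty.of_retract (P := S)
      (Retract.mk (Arrow.homMk _ _ e3) (Arrow.homMk _ _ e4)
        (Arrow.hom_ext _ _ e1 e2)) (hS.restrict U.2 W.2 a hg))

lemma quotientClass_hasTwoOutOfThreeProperty (hS : StableUnderProd Φ S) [S.RespectsIso]
    [S.HasTwoOutOfThreeProperty] : (quotientClass (Φ := Φ) S).HasTwoOutOfThreeProperty where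
  comp_mem φ ψ hφ hψ := by
    obtain ⟨U, ⟨f, rfl, hf⟩, g, rfl, hg⟩ := ((eventually_exists_rep_of_quotientClass hS hφ).and
      (eventually_exists_rep_of_quotientClass hS hψ)).exists
    rw [ofHom_comp_ofHom]
    refine quotientClass_ofHom U.2 ?_
    rw [level_comp]
    exact S.comp_mem _ _ hf hg
  of_postcomp φ ψ hψ h := by
    obtain ⟨U, ⟨f, rfl⟩, g, rfl, hg⟩ := ((eventually_exists_rep φ).and
      (eventually_exists_rep_of_quotientClass hS hψ)).exists
    rw [ofHom_comp_ofHom, quotientClass_ofHom_iff hS] at h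
    obtain ⟨W, h, ⟨a⟩⟩ := (h.and (eventually_nonempty_hom U.2)).exists
    have h' := h a
    rw [restrict_comp, level_comp] at h'
    rw [← ofHom_restrict U.2 W.2 f a]
    exact quotientClass_ofHom W.2 (S.of_postcomp _ _ (hS.restrict U.2 W.2 a hg) h')
  of_precomp φ ψ hφ h := by
    obtain ⟨U, ⟨f, rfl, hf⟩, g, rfl⟩ := ((eventually_exists_rep_of_quotientClass hS hφ).and
      (eventually_exists_rep ψ)).exists
    rw [ofHom_comp_ofHom, quotientClass_ofHom_iff hS] at h
    obtain ⟨W, h, ⟨a⟩⟩ := (h.and (eventually_nonempty_hom U.2)).exists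
    have h' := h a
    rw [restrict_comp, level_comp] at h'
    rw [← ofHom_restrict U.2 W.2 g a]
    exact quotientClass_ofHom W.2 (S.of_precomp _ _ (hS.restrict U.2 W.2 a hf) h')

lemma quotientClass_hasLiftingProperty (hS : StableUnderProd Φ S) (hT : StableUnderProd Φ T)
    [S.RespectsIso] [T.RespectsIso]
    (h : ∀ {A B X Y : C} (i : A ⟶ B) (p : X ⟶ Y), S i → T p → HasLiftingProperty i p)
    {A B X Y : FilterQuotient Φ} {ι : A ⟶ B} {π : X ⟶ Y} (hι : quotientClass S ι)
    (hπ : quotientClass T π) : HasLiftingProperty ι π where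
  sq_hasLift {μ ν} sq := by
    obtain ⟨U, ⟨⟨⟨i, rfl, hi⟩, p, rfl, hp⟩, m, rfl⟩, n, rfl⟩ :=
      ((((eventually_exists_rep_of_quotientClass hS hι).and
      (eventually_exists_rep_of_quotientClass hT hπ)).and
      (eventually_exists_rep μ)).and (eventually_exists_rep ν)).exists
    have e := sq.w
    rw [ofHom_comp_ofHom, ofHom_comp_ofHom] at e
    obtain ⟨W, e, ⟨a⟩⟩ := ((eventually_of_eq _ e).and (eventually_nonempty_hom U.2)).exists
    replace e := congrArg level (e a)
    simp only [restrict_comp, level_comp] at e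
    have := h _ _ (hS.restrict U.2 W.2 a hi) (hT.restrict U.2 W.2 a hp)
    let sq' := CommSq.mk e
    -- The lift lies over `W` automatically: `level p` and the bottom side of the square both
    -- commute with the projections to `W`.
    have hl : level (sq'.lift ≫ prod.fst) = sq'.lift := by
      refine eq_level _ ?_
      rw [← level_snd (prod.map (𝟙 _) a ≫ p), sq'.fac_right_assoc, level_snd]
    refine ⟨⟨⟨ofHom W.2 (sq'.lift ≫ prod.fst), ?_, ?_⟩⟩⟩
    · rw [← ofHom_restrict U.2 W.2 i a, ← ofHom_restrict U.2 W.2 m a, ofHom_comp_ofHom,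
        sq'.fac_left_assoc, level_fst]
    · have hr := sq'.fac_right =≫ prod.fst
      rw [Category.assoc, level_fst, level_fst] at hr
      rw [← ofHom_restrict U.2 W.2 p a, ← ofHom_restrict U.2 W.2 n a, ofHom_comp_ofHom, hl, hr]

/-- An object over a subterminal object `U` is isomorphic to its product with `U`. -/
@[simps]
def prodSubterminalIso {U Z : C} (hU : IsSubterminal U) (z : Z ⟶ U) : Z ⨯ U ≅ Z where
  hom := prod.fst
  inv := prod.lift (𝟙 _) z
  hom_inv_id := by
    ext
    · simp [prod.lift_fst]
    · exact hU _ _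
  inv_hom_id := prod.lift_fst _ _

/-- The middle object `Z` of a factorization of `level f` maps to the subterminal `U`, so `Z ⨯ U ≅
Z` and both factors are already levels up to isomorphism. No shrinking, and so no stability under
products, is needed. -/
lemma quotientClass_hasFactorization [S.RespectsIso] [T.RespectsIso]
    [MorphismProperty.HasFactorization S T] :
    MorphismProperty.HasFactorization (quotientClass (Φ := Φ) S) (quotientClass T) where
  nonempty_mapFactorizationData {X Y} φ := by
    obtain ⟨U, hU, f, rfl⟩ := ofHom_surjective φ
    obtain ⟨Z, i, p, fac, hi, hp⟩ := MorphismProperty.factorizationData S T (level f)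
    have hsub := isSubterminal_of_mem hU
    let e := prodSubterminalIso hsub (p ≫ prod.snd)
    have h1 : level i = i ≫ e.inv := by
      ext
      · simp [e, level_fst, prod.lift_fst]
      · exact hsub _ _
    have h2 : level (prod.fst ≫ p ≫ prod.fst : Z ⨯ U ⟶ Y.obj) = e.hom ≫ p := by
      ext
      · simp [e, level_fst]
      · exact hsub _ _
    refine ⟨{
      Z := ⟨Z⟩
      i := ofHom (Y := ⟨Z⟩) hU i
      p := ofHom (X := ⟨Z⟩) hU (prod.fst ≫ p ≫ prod.fst)
      fac := ?_
      hi := quotientClass_ofHom hU ?_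
      hp := quotientClass_ofHom hU ?_ }⟩
    · rw [ofHom_comp_ofHom]
      dsimp only
      rw [← Category.assoc, level_fst, reassoc_of% fac, level_fst]
    · rw [h1]
      exact (MorphismProperty.cancel_right_of_respectsIso S _ _).2 hi
    · rw [h2]
      exact (MorphismProperty.cancel_left_of_respectsIso T _ _).2 hp

end Classes

/-- The inverse is the class of the identity of `X ⨯ U`, read as a representative of a morphism from
`X` to `X ⨯ U`. -/
lemma isIso_proj_map_fst {U : C} (hU : Φ U) (X : C) :
    IsIso ((proj Φ).map (prod.fst : X ⨯ U ⟶ X)) := by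
  have hsub := isSubterminal_of_mem hU
  have h : level (prod.fst ≫ prod.fst : (X ⨯ U) ⨯ U ⟶ X) = prod.fst := by
    ext
    · rw [level_fst]
    · exact hsub _ _
  have e := proj_map (prod.fst : X ⨯ U ⟶ X) hU
  refine ⟨ofHom (X := ⟨X⟩) (Y := ⟨X ⨯ U⟩) hU (𝟙 (X ⨯ U)), ?_, ?_⟩
  · refine (congrArg (· ≫ _) e).trans ?_
    refine (ofHom_comp_ofHom (X := ⟨X ⨯ U⟩) (Y := ⟨X⟩) (Z := ⟨X ⨯ U⟩) hU _ _).trans ?_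
    refine Eq.trans ?_ (FilterQuotient.id_eq hU).symm
    exact congrArg (ofHom (X := ⟨X ⨯ U⟩) (Y := ⟨X ⨯ U⟩) hU) ((Category.comp_id _).trans h)
  · refine (congrArg (_ ≫ ·) e).trans ?_
    refine (ofHom_comp_ofHom (X := ⟨X⟩) (Y := ⟨X ⨯ U⟩) (Z := ⟨X⟩) hU _ _).trans ?_
    refine Eq.trans ?_ (FilterQuotient.id_eq hU).symm
    refine congrArg (ofHom (X := ⟨X⟩) (Y := ⟨X⟩) hU) ?_
    rw [← Category.assoc, level_fst, Category.id_comp]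

end Quotient

/-! ### Induced functors and the induced adjunction -/

section Functors

variable {C : Type u₁} [Category.{v₁} C] [HasFiniteProducts C]
  {D : Type u₂} [Category.{v₂} D] [HasFiniteProducts D]
  {Φ : ObjectProperty C} [IsDirectedSubterminal Φ] {Ψ : ObjectProperty D} [IsDirectedSubterminal Ψ]

lemma prodComparison_level_mapRep (F : C ⥤ D) {X Y U : C} (hX : IsIso (prodComparison F X U))
    (f : X ⨯ U ⟶ Y) :
    prodComparison F X U ≫ level (mapRep F hX f) =
      F.map (level f) ≫ prodComparison F Y U := by
  ext
  · rw [Category.assoc, Category.assoc, level_fst, prodComparison_mapRep, prodComparison_fst,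
      ← F.map_comp, level_fst]
  · rw [Category.assoc, Category.assoc, level_snd, prodComparison_snd, prodComparison_snd,
      ← F.map_comp, level_snd]

/-- The product comparisons identify `F.map (level f)` with the level of the image representative.
No stability is asked of `S`, so it may also record conditions on source and target, as Ken Brown's
lemma requires later. -/
lemma quotientClass_inducedFunctor_map {F : C ⥤ D} (hF : ∀ U : C, Φ U → Ψ (F.obj U))
    (hprod : ∀ X U : C, Φ U → IsIso (prodComparison F X U))
    {S : MorphismProperty C} {T : MorphismProperty D} [T.RespectsIso]
    (hST : ∀ {X Y : C} (f : X ⟶ Y), S f → T (F.map f))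
    {X Y : FilterQuotient Φ} {φ : X ⟶ Y} (hφ : quotientClass S φ) :
    quotientClass T ((inducedFunctor F hF hprod).map φ) := by
  obtain ⟨U, hU, f, rfl, hf⟩ := hφ
  have hX := hprod X.obj U hU
  have hY := hprod Y.obj U hU
  refine ⟨F.obj U, hF U hU, mapRep F hX f, inducedFunctor_map_ofHom F hF hprod hU f, ?_⟩
  exact (T.arrow_mk_iso_iff (Arrow.isoMk (asIso (prodComparison F X.obj U))
    (asIso (prodComparison F Y.obj U)) (prodComparison_level_mapRep F hX f))).1 (hST _ hf)

lemma inducedFunctor_map_proj_map (F : C ⥤ D) (hF : ∀ U : C, Φ U → Ψ (F.obj U))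
    (hprod : ∀ X U : C, Φ U → IsIso (prodComparison F X U)) {X Y : C} (f : X ⟶ Y) :
    (inducedFunctor F hF hprod).map ((proj Φ).map f) = (proj Ψ).map (F.map f) := by
  obtain ⟨U, hU⟩ := IsDirectedSubterminal.nonempty (Φ := Φ)
  have hX := hprod X U hU
  have e : mapRep F hX (prod.fst ≫ f) = prod.fst ≫ F.map f := by
    rw [← cancel_epi (prodComparison F X U), prodComparison_mapRep, F.map_comp,
      prodComparison_fst_assoc]
  rw [proj_map f hU, proj_map (F.map f) (hF U hU)]
  exact congrArg (ofHom (X := ⟨F.obj X⟩) (Y := ⟨F.obj Y⟩) (hF U hU)) e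

/-- A morphism of the filter quotient is, up to the isomorphism `X ⨯ U ≅ X`, in the image of the
projection functor. -/
lemma proj_map_fst_comp {X Y : FilterQuotient Φ} {U : C} (hU : Φ U) (f : X.obj ⨯ U ⟶ Y.obj) :
    (proj Φ).map (prod.fst : X.obj ⨯ U ⟶ X.obj) ≫ ofHom (X := X) (Y := Y) hU f =
      (proj Φ).map f := by
  have h : level (prod.fst ≫ prod.fst : (X.obj ⨯ U) ⨯ U ⟶ X.obj) = prod.fst := by
    ext
    · rw [level_fst]
    · exact isSubterminal_of_mem hU _ _
  refine (congrArg (· ≫ _) (proj_map _ hU)).trans ?_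
  refine (ofHom_comp_ofHom (X := ⟨X.obj ⨯ U⟩) (Y := X) (Z := Y) hU _ _).trans ?_
  refine Eq.trans ?_ (proj_map f hU).symm
  exact congrArg (ofHom (X := ⟨X.obj ⨯ U⟩) (Y := Y) hU) (congrArg (· ≫ f) h)

/-- Naturality on the image of the projection functor implies naturality on the filter quotient. -/
def natTransOfProj {E : Type*} [Category E] {H K : FilterQuotient Φ ⥤ E}
    (τ : ∀ X : FilterQuotient Φ, H.obj X ⟶ K.obj X)
    (hτ : ∀ {X Y : C} (f : X ⟶ Y), H.map ((proj Φ).map f) ≫ τ ((proj Φ).obj Y) =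
      τ ((proj Φ).obj X) ≫ K.map ((proj Φ).map f)) : H ⟶ K where
  app := τ
  naturality X Y φ := by
    obtain ⟨U, hU, f, rfl⟩ := ofHom_surjective φ
    -- The class of `f` is `proj f` preceded by the inverse of `proj prod.fst`, so naturality at
    -- these two images suffices.
    have := isIso_proj_map_fst hU X.obj
    have h1 := hτ (prod.fst : X.obj ⨯ U ⟶ X.obj)
    have h2 := hτ f
    rw [← proj_map_fst_comp hU f] at h2
    refine (cancel_epi (H.map ((proj Φ).map (prod.fst : X.obj ⨯ U ⟶ X.obj)))).1 ?_
    refine (Category.assoc _ _ _).symm.trans ?_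
    refine (congrArg (· ≫ _) (H.map_comp _ _).symm).trans (h2.trans ?_)
    refine (congrArg (_ ≫ ·) (K.map_comp _ _)).trans ?_
    refine (Category.assoc _ _ _).symm.trans ?_
    exact (congrArg (· ≫ _) h1.symm).trans (Category.assoc _ _ _)

variable {F : C ⥤ D} {G : D ⥤ C}

/-- The adjunction between filter quotients induced by an adjunction. -/
def inducedAdjunction (adj : F ⊣ G) (hF : ∀ U : C, Φ U → Ψ (F.obj U))
    (hF' : ∀ X U : C, Φ U → IsIso (prodComparison F X U))
    (hG : ∀ V : D, Ψ V → Φ (G.obj V))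
    (hG' : ∀ X U : D, Ψ U → IsIso (prodComparison G X U)) :
    (inducedFunctor F hF hF' : FilterQuotient Φ ⥤ FilterQuotient Ψ) ⊣
      inducedFunctor G hG hG' where
  unit := natTransOfProj (fun X ↦ (proj Φ).map (adj.unit.app X.obj)) (fun {X Y} f ↦ by
    refine Eq.trans ?_ (congrArg ((proj Φ).map (adj.unit.app X) ≫ ·)
      ((congrArg (inducedFunctor G hG hG').map (inducedFunctor_map_proj_map F hF hF' f)).trans
        (inducedFunctor_map_proj_map G hG hG' (F.map f))).symm)
    exact ((proj Φ).map_comp _ _).symm.trans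
      ((congrArg (proj Φ).map (adj.unit.naturality f)).trans ((proj Φ).map_comp _ _)))
  counit := natTransOfProj (fun Y ↦ (proj Ψ).map (adj.counit.app Y.obj)) (fun {X Y} f ↦ by
    refine (congrArg (· ≫ (proj Ψ).map (adj.counit.app Y))
      ((congrArg (inducedFunctor F hF hF').map (inducedFunctor_map_proj_map G hG hG' f)).trans
        (inducedFunctor_map_proj_map F hF hF' (G.map f)))).trans ?_
    exact ((proj Ψ).map_comp _ _).symm.trans
      ((congrArg (proj Ψ).map (adj.counit.naturality f)).trans ((proj Ψ).map_comp _ _)))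
  -- Every object of the quotient comes from the original category, so the triangle identities are
  -- images of the original ones.
  left_triangle_components X := by
    refine (congrArg (· ≫ (proj Ψ).map (adj.counit.app (F.obj X.obj)))
      (inducedFunctor_map_proj_map F hF hF' (adj.unit.app X.obj))).trans ?_
    exact ((proj Ψ).map_comp _ _).symm.trans
      ((congrArg (proj Ψ).map (adj.left_triangle_components X.obj)).trans ((proj Ψ).map_id _))
  right_triangle_components Y := by
    refine (congrArg ((proj Φ).map (adj.unit.app (G.obj Y.obj)) ≫ ·)
      (inducedFunctor_map_proj_map G hG hG' (adj.counit.app Y.obj))).trans ?_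
    exact ((proj Φ).map_comp _ _).symm.trans
      ((congrArg (proj Φ).map (adj.right_triangle_components Y.obj)).trans ((proj Φ).map_id _))

end Functors

/-! ### Quillen adjunctions and Ken Brown's lemma -/

section QuillenAdjunction

variable {M : Type u₁} [Category.{v₁} M] [ModelCategory M]
  {N : Type u₂} [Category.{v₂} N] [ModelCategory N] {F : M ⥤ N} {G : N ⥤ M} {adj : F ⊣ G}

/-- Fibrations are the maps with the right lifting property against trivial cofibrations, and
lifting problems transpose across the adjunction. -/
lemma IsQuillenAdjunction.fibrations_map (h : IsQuillenAdjunction adj) {X Y : N} (p : X ⟶ Y)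
    (hp : fibrations N p) : fibrations M (G.map p) := by
  rw [← trivialCofibrations_rlp] at hp ⊢
  intro A B i hi
  rw [← adj.hasLiftingProperty_iff]
  exact hp _ (h.trivialCofibrations_map i hi)

lemma IsQuillenAdjunction.trivialFibrations_map (h : IsQuillenAdjunction adj) {X Y : N} (p : X ⟶ Y)
    (hp : trivialFibrations N p) : trivialFibrations M (G.map p) := by
  rw [← cofibrations_rlp] at hp ⊢
  intro A B i hi
  rw [← adj.hasLiftingProperty_iff]
  exact hp _ (h.cofibrations_map i hi)

/-- Ken Brown's lemma: `f` factors as a trivial cofibration followed by a retraction of a trivial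
cofibration, and `F` preserves both kinds of map up to two-out-of-three. -/
lemma IsQuillenAdjunction.weakEquivalences_map_of_isCofibrant (h : IsQuillenAdjunction adj)
    {X Y : M} (f : X ⟶ Y) (hX : IsCofibrant X) (hY : IsCofibrant Y) (hf : weakEquivalences M f) :
    weakEquivalences N (F.map f) := by
  have : WeakEquivalence f := ⟨hf⟩
  obtain ⟨b⟩ : Nonempty (CofibrantBrownFactorization f) := inferInstance
  have hi := (h.trivialCofibrations_map b.i (mem_trivialCofibrations_iff _ |>.2
    ⟨⟨b.hi⟩, inferInstance⟩)).2
  have hs := (h.trivialCofibrations_map b.s (mem_trivialCofibrations b.s)).2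
  have hp : weakEquivalences N (F.map b.p) := by
    refine (weakEquivalences N).of_precomp (F.map b.s) _ hs ?_
    rw [← F.map_comp, b.s_p, F.map_id]
    exact (weakEquivalences N).id_mem _
  rw [← b.fac, F.map_comp]
  exact (weakEquivalences N).comp_mem _ _ hi hp

lemma IsQuillenAdjunction.weakEquivalences_map_of_isFibrant (h : IsQuillenAdjunction adj)
    {X Y : N} (f : X ⟶ Y) (hX : IsFibrant X) (hY : IsFibrant Y) (hf : weakEquivalences N f) :
    weakEquivalences M (G.map f) := by
  have : WeakEquivalence f := ⟨hf⟩
  obtain ⟨b⟩ : Nonempty (FibrantBrownFactorization f) := inferInstance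
  have hp := (h.trivialFibrations_map b.p (mem_trivialFibrations_iff _ |>.2
    ⟨⟨b.hp⟩, inferInstance⟩)).2
  have hr := (h.trivialFibrations_map b.r (mem_trivialFibrations b.r)).2
  have hi : weakEquivalences M (G.map b.i) := by
    refine (weakEquivalences M).of_postcomp _ (G.map b.r) hr ?_
    rw [← G.map_comp, b.i_r, G.map_id]
    exact (weakEquivalences M).id_mem _
  rw [← b.fac, G.map_comp]
  exact (weakEquivalences M).comp_mem _ _ hi hp

/-- A Quillen equivalence is a Quillen adjunction whose derived unit and counit are equivalences. -/
lemma isQuillenEquivalence_iff {C : Type u₁} [Category.{v₁} C] [CategoryWithFibrations C]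
    [CategoryWithCofibrations C] [CategoryWithWeakEquivalences C]
    {D : Type u₂} [Category.{v₂} D] [CategoryWithFibrations D]
    [CategoryWithCofibrations D] [CategoryWithWeakEquivalences D]
    {F : C ⥤ D} {G : D ⥤ C} [HasInitial C] [HasTerminal D] (adj : F ⊣ G) :
    IsQuillenEquivalence adj ↔ IsHomotopicalLocalization adj ∧ IsHomotopicalColocalization adj := by
  constructor
  · rintro ⟨h, h'⟩
    refine ⟨⟨h, fun Y Q q hY hQ hq ↦ ?_⟩, h, fun X R j hX hR hj ↦ ?_⟩
    · have e := (h' Q Y ((adj.homEquiv Q Y).symm q) hQ hY).2 (by rwa [Equiv.apply_symm_apply])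
      rw [adj.homEquiv_counit] at e
      exact e
    · have e := (h' _ _ _ hX hR).1 hj
      rw [adj.homEquiv_unit] at e
      exact e
  · rintro ⟨⟨h, h1⟩, -, h2⟩
    refine ⟨h, fun X Y f hX hY ↦ ⟨fun hf ↦ ?_, fun hf ↦ ?_⟩⟩
    · rw [adj.homEquiv_unit]
      exact h2 _ _ f hX hY hf
    · have e : F.map (adj.homEquiv X Y f) ≫ adj.counit.app Y = f :=
        (adj.homEquiv_counit _ _ _).symm.trans (Equiv.symm_apply_apply _ _)
      exact (congrArg (fun t : F.obj X ⟶ Y ↦ weakEquivalences D t) e).mp (h1 _ _ _ hY hX hf)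

end QuillenAdjunction

/-! ### The model structure; cofibrant and fibrant objects of the quotient -/

section ModelStructure

variable {M : Type u} [Category.{v} M] [ModelCategory M] (Φ : ObjectProperty M)

/-- `f ⨯ U` is a pullback of `f`, which is why a model filter imposes no condition on fibrations. -/
lemma stableUnderProd_fibrations : StableUnderProd Φ (fibrations M) :=
  fun _ _ f U _ hf ↦ (fibrations M).of_isPullback (IsPullback.of_prod_fst_with_id f U) hf

variable [IsModelFilter Φ]

lemma stableUnderProd_cofibrations : StableUnderProd Φ (cofibrations M) :=
  IsModelFilter.cofibrations_stable

lemma stableUnderProd_weakEquivalences : StableUnderProd Φ (weakEquivalences M) :=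
  IsModelFilter.weakEquivalences_stable

lemma trivialCofibrations_filterQuotient :
    trivialCofibrations (FilterQuotient Φ) = quotientClass (trivialCofibrations M) :=
  quotientClass_inf (stableUnderProd_cofibrations Φ) (stableUnderProd_weakEquivalences Φ)

lemma trivialFibrations_filterQuotient :
    trivialFibrations (FilterQuotient Φ) = quotientClass (trivialFibrations M) :=
  quotientClass_inf (stableUnderProd_fibrations Φ) (stableUnderProd_weakEquivalences Φ)

lemma stableUnderProd_trivialCofibrations : StableUnderProd Φ (trivialCofibrations M) :=
  (stableUnderProd_cofibrations Φ).inf (stableUnderProd_weakEquivalences Φ)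

lemma stableUnderProd_trivialFibrations : StableUnderProd Φ (trivialFibrations M) :=
  (stableUnderProd_fibrations Φ).inf (stableUnderProd_weakEquivalences Φ)

/-- The filter quotient of a model category by a model filter carries a model structure. -/
theorem isModelStructure_filterQuotient : IsModelStructure (FilterQuotient Φ) where
  lifting_trivialCofibration i p hi hp := by
    rw [trivialCofibrations_filterQuotient] at hi
    exact quotientClass_hasLiftingProperty (stableUnderProd_trivialCofibrations Φ)
      (stableUnderProd_fibrations Φ)
      (fun i p hi hp ↦ MorphismProperty.hasLiftingProperty_of_wfs i p hi hp) hi hp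
  lifting_trivialFibration i p hi hp := by
    rw [trivialFibrations_filterQuotient] at hp
    exact quotientClass_hasLiftingProperty (stableUnderProd_cofibrations Φ)
      (stableUnderProd_trivialFibrations Φ)
      (fun i p hi hp ↦ MorphismProperty.hasLiftingProperty_of_wfs i p hi hp) hi hp
  factorization_trivialCofibration := by
    rw [trivialCofibrations_filterQuotient]
    exact quotientClass_hasFactorization
  factorization_trivialFibration := by
    rw [trivialFibrations_filterQuotient]
    exact quotientClass_hasFactorization
  retract_fibrations := quotientClass_isStableUnderRetracts (stableUnderProd_fibrations Φ)
  retract_cofibrations := quotientClass_isStableUnderRetracts (stableUnderProd_cofibrations Φ)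
  retract_weakEquivalences :=
    quotientClass_isStableUnderRetracts (stableUnderProd_weakEquivalences Φ)
  two_out_of_three := quotientClass_hasTwoOutOfThreeProperty (stableUnderProd_weakEquivalences Φ)

instance : (fibrations (FilterQuotient Φ)).IsStableUnderRetracts :=
  (isModelStructure_filterQuotient Φ).retract_fibrations

instance : (cofibrations (FilterQuotient Φ)).IsStableUnderRetracts :=
  (isModelStructure_filterQuotient Φ).retract_cofibrations

instance : (weakEquivalences (FilterQuotient Φ)).IsStableUnderRetracts :=
  (isModelStructure_filterQuotient Φ).retract_weakEquivalences

instance : (weakEquivalences (FilterQuotient Φ)).HasTwoOutOfThreeProperty :=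
  (isModelStructure_filterQuotient Φ).two_out_of_three

lemma weakEquivalences_proj_map {X Y : M} {f : X ⟶ Y} (hf : weakEquivalences M f) :
    weakEquivalences (FilterQuotient Φ) ((proj Φ).map f) :=
  quotientClass_proj_map (stableUnderProd_weakEquivalences Φ) hf

/-- The image of an initial object under the projection functor is initial. -/
def isInitialProj : IsInitial ((proj Φ).obj (⊥_ M)) :=
  IsInitial.ofUniqueHom (fun X ↦ (proj Φ).map (initial.to X.obj)) (fun X φ ↦ by
    obtain ⟨U, hU, f, rfl⟩ := ofHom_surjective φ
    exact (congrArg (ofHom hU) (eq_of_prod_initial (isSubterminal_of_mem hU) f _)).trans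
      (proj_map _ hU).symm)

/-- The image of a terminal object under the projection functor is terminal. -/
def isTerminalProj : IsTerminal ((proj Φ).obj (⊤_ M)) :=
  IsTerminal.ofUniqueHom (fun X ↦ (proj Φ).map (terminal.from X.obj)) (fun X φ ↦ by
    obtain ⟨U, hU, f, rfl⟩ := ofHom_surjective φ
    exact (congrArg (ofHom hU) (terminalIsTerminal.hom_ext f _)).trans
      (proj_map _ hU).symm)

/-- The product of an initial object with a subterminal object is initial. -/
def isInitialProd {U : M} (hU : IsSubterminal U) : IsInitial ((⊥_ M) ⨯ U) :=
  IsInitial.ofUniqueHom (fun X ↦ prod.fst ≫ initial.to X)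
    (fun _ _ ↦ eq_of_prod_initial hU _ _)

variable {Φ}

lemma isCofibrant_proj {X : M} (hX : IsCofibrant X) : IsCofibrant ((proj Φ).obj X) := by
  rw [isCofibrant_iff_of_isInitial ((proj Φ).map (initial.to X)) (isInitialProj Φ)]
  exact ⟨quotientClass_proj_map (stableUnderProd_cofibrations Φ) hX.mem⟩

lemma isFibrant_proj {X : M} (hX : IsFibrant X) : IsFibrant ((proj Φ).obj X) := by
  rw [isFibrant_iff_of_isTerminal ((proj Φ).map (terminal.from X)) (isTerminalProj Φ)]
  exact ⟨quotientClass_proj_map (stableUnderProd_fibrations Φ) hX.mem⟩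

/-- Cofibrancy in the quotient gives a cofibration `⊥ ⨯ U ⟶ X ⨯ U`, whose source is again initial
because `U` is subterminal. -/
lemma eventually_isCofibrant_prod {X : FilterQuotient Φ} (hX : IsCofibrant X) :
    ∀ᶠ U in levels Φ, IsCofibrant (X.obj ⨯ U.1) := by
  rw [isCofibrant_iff_of_isInitial (A := (proj Φ).obj (⊥_ M)) ((isInitialProj Φ).to X)
    (isInitialProj Φ)] at hX
  filter_upwards [eventually_exists_rep_of_quotientClass (stableUnderProd_cofibrations Φ)
    hX.mem] with U hU
  obtain ⟨f, -, hf⟩ := hU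
  rw [isCofibrant_iff_of_isInitial (level f) (isInitialProd (isSubterminal_of_mem U.2))]
  exact ⟨hf⟩

lemma isFibrant_of_mem {U : M} (hU : Φ U) : IsFibrant U :=
  (IsModelFilter.isDiscreteHomotopicallySubterminal hU).1.1

/-- Here `X ⨯ U` is fibred over `⊤ ⨯ U`, which is fibrant because members of a model filter are. -/
lemma eventually_isFibrant_prod {X : FilterQuotient Φ} (hX : IsFibrant X) :
    ∀ᶠ U in levels Φ, IsFibrant (X.obj ⨯ U.1) := by
  rw [isFibrant_iff_of_isTerminal (Y := (proj Φ).obj (⊤_ M)) ((isTerminalProj Φ).from X)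
    (isTerminalProj Φ)] at hX
  filter_upwards [eventually_exists_rep_of_quotientClass (stableUnderProd_fibrations Φ)
    hX.mem] with U hU
  obtain ⟨f, -, hf⟩ : ∃ f : X.obj ⨯ U.1 ⟶ ⊤_ M, _ ∧ fibrations M (level f) := hU
  have := isFibrant_of_mem U.2
  have : Fibration (level f) := ⟨hf⟩
  have : IsFibrant (⊤_ M) := ⟨by
    rw [Subsingleton.elim (terminal.from (⊤_ M)) (𝟙 _)]
    exact (fibrations M).id_mem _⟩
  have : IsFibrant ((⊤_ M) ⨯ U.1) := isFibrant_of_fibration (prod.snd : (⊤_ M) ⨯ U.1 ⟶ U.1)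
  exact isFibrant_of_fibration (level f)

/-- A weak equivalence between cofibrant objects of the filter quotient is represented by a weak
equivalence between cofibrant objects. -/
lemma quotientClass_of_isCofibrant {X Y : FilterQuotient Φ} {φ : X ⟶ Y} (hX : IsCofibrant X)
    (hY : IsCofibrant Y) (hφ : weakEquivalences _ φ) :
    quotientClass (fun A B (f : A ⟶ B) ↦ IsCofibrant A ∧ IsCofibrant B ∧ weakEquivalences M f)
      φ := by
  obtain ⟨U, ⟨hX, hY⟩, f, rfl, hf⟩ := (((eventually_isCofibrant_prod hX).and
    (eventually_isCofibrant_prod hY)).and (eventually_exists_rep_of_quotientClass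
      (stableUnderProd_weakEquivalences Φ) hφ)).exists
  exact quotientClass_ofHom U.2 ⟨hX, hY, hf⟩

/-- A weak equivalence between fibrant objects of the filter quotient is represented by a weak
equivalence between fibrant objects. -/
lemma quotientClass_of_isFibrant {X Y : FilterQuotient Φ} {φ : X ⟶ Y} (hX : IsFibrant X)
    (hY : IsFibrant Y) (hφ : weakEquivalences _ φ) :
    quotientClass (fun A B (f : A ⟶ B) ↦ IsFibrant A ∧ IsFibrant B ∧ weakEquivalences M f)
      φ := by
  obtain ⟨U, ⟨hX, hY⟩, f, rfl, hf⟩ := (((eventually_isFibrant_prod hX).and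
    (eventually_isFibrant_prod hY)).and (eventually_exists_rep_of_quotientClass
      (stableUnderProd_weakEquivalences Φ) hφ)).exists
  exact quotientClass_ofHom U.2 ⟨hX, hY, hf⟩

end ModelStructure

/-! ### Homotopical properties of the induced adjunction -/

section Induced

variable {M : Type u₁} [Category.{v₁} M] [ModelCategory M]
    {N : Type u₂} [Category.{v₂} N] [ModelCategory N]
    {Φ : ObjectProperty M} [IsModelFilter Φ] {Ψ : ObjectProperty N} [IsModelFilter Ψ]
    {F : M ⥤ N} {G : N ⥤ M} {adj : F ⊣ G}
    (hF : ∀ U : M, Φ U → Ψ (F.obj U))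
    (hF' : ∀ X U : M, Φ U → IsIso (prodComparison F X U))
    (hG : ∀ V : N, Ψ V → Φ (G.obj V))
    (hG' : ∀ X U : N, Ψ U → IsIso (prodComparison G X U))

lemma isQuillenAdjunction_inducedAdjunction (h : IsQuillenAdjunction adj) :
    IsQuillenAdjunction (inducedAdjunction adj hF hF' hG hG') where
  cofibrations_map φ hφ := quotientClass_inducedFunctor_map hF hF' h.cofibrations_map hφ
  trivialCofibrations_map φ hφ := by
    rw [trivialCofibrations_filterQuotient] at hφ ⊢
    exact quotientClass_inducedFunctor_map hF hF' h.trivialCofibrations_map hφ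

lemma derivedCounitIsEquivalence_inducedAdjunction (h : IsQuillenAdjunction adj)
    (h' : DerivedCounitIsEquivalence adj) :
    DerivedCounitIsEquivalence (inducedAdjunction adj hF hF' hG hG') := by
  intro Y Q q hY hQ hq
  obtain ⟨V, hYV⟩ := (eventually_isFibrant_prod hY).exists
  let p : (proj Ψ).obj (Y.obj ⨯ V.1) ⟶ Y := (proj Ψ).map prod.fst
  have hp : IsIso p := isIso_proj_map_fst V.2 Y.obj
  -- The reference cofibrant replacement is chosen in `M`, where the hypothesis on the derived
  -- counit applies; making `r` a trivial fibration lets `q` lift through its image.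
  obtain ⟨Z, i, r, -, hi, hr⟩ := MorphismProperty.factorizationData (cofibrations M)
    (trivialFibrations M) (initial.to (G.obj (Y.obj ⨯ V.1)))
  have hZ : IsCofibrant Z := ⟨by rwa [Subsingleton.elim (initial.to Z) i]⟩
  let r' : (proj Φ).obj Z ⟶ (inducedFunctor G hG hG').obj ((proj Ψ).obj (Y.obj ⨯ V.1)) :=
    (proj Φ).map r
  have hr' : trivialFibrations (FilterQuotient Φ) r' := by
    rw [trivialFibrations_filterQuotient]
    exact quotientClass_proj_map (stableUnderProd_trivialFibrations Φ) hr
  have hπ : trivialFibrations _ (r' ≫ (inducedFunctor G hG hG').map p) :=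
    (MorphismProperty.cancel_right_of_respectsIso (trivialFibrations (FilterQuotient Φ)) _ _).2 hr'
  have := (isModelStructure_filterQuotient Φ).lifting_trivialFibration (initial.to Q) _ hQ.mem hπ
  let sq : CommSq (initial.to ((proj Φ).obj Z)) (initial.to Q)
    (r' ≫ (inducedFunctor G hG hG').map p) q := ⟨Subsingleton.elim _ _⟩
  have hl : weakEquivalences _ sq.lift :=
    (weakEquivalences _).of_postcomp _ _ hπ.2 (by rwa [sq.fac_right])
  -- `F` need not preserve all weak equivalences, so the lift is represented at a level where its
  -- source and target are cofibrant in `M`.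
  have hFl : weakEquivalences _ ((inducedFunctor F hF hF').map sq.lift) :=
    quotientClass_inducedFunctor_map hF hF'
      (fun f hf ↦ h.weakEquivalences_map_of_isCofibrant f hf.1 hf.2.1 hf.2.2)
      (quotientClass_of_isCofibrant hQ (isCofibrant_proj hZ) hl)
  have hc : weakEquivalences _ ((inducedFunctor F hF hF').map r' ≫
      (inducedAdjunction adj hF hF' hG hG').counit.app ((proj Ψ).obj (Y.obj ⨯ V.1))) := by
    have e := weakEquivalences_proj_map Ψ (h' _ _ r hYV hZ hr.2)
    rw [Functor.map_comp, ← inducedFunctor_map_proj_map F hF hF'] at e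
    exact e
  have nat : (inducedFunctor F hF hF').map ((inducedFunctor G hG hG').map p) ≫
      (inducedAdjunction adj hF hF' hG hG').counit.app Y =
      (inducedAdjunction adj hF hF' hG hG').counit.app ((proj Ψ).obj (Y.obj ⨯ V.1)) ≫ p :=
    (inducedAdjunction adj hF hF' hG hG').counit.naturality p
  rw [← sq.fac_right, Functor.map_comp, Functor.map_comp, Category.assoc, Category.assoc]
  refine (weakEquivalences _).comp_mem _ _ hFl ?_
  refine (congrArg (fun t : (inducedFunctor F hF hF').obj ((proj Φ).obj Z) ⟶ Y ↦
    weakEquivalences (FilterQuotient Ψ) t) ((congrArg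
    ((inducedFunctor F hF hF').map r' ≫ ·) nat).trans (Category.assoc _ _ _).symm)).mpr ?_
  exact (MorphismProperty.cancel_right_of_respectsIso
    (weakEquivalences (FilterQuotient Ψ)) _ _).2 hc

lemma derivedUnitIsEquivalence_inducedAdjunction (h : IsQuillenAdjunction adj)
    (h' : DerivedUnitIsEquivalence adj) :
    DerivedUnitIsEquivalence (inducedAdjunction adj hF hF' hG hG') := by
  intro X R j hX hR hj
  obtain ⟨U, hXU⟩ := (eventually_isCofibrant_prod hX).exists
  let p : (proj Φ).obj (X.obj ⨯ U.1) ⟶ X := (proj Φ).map prod.fst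
  have hp : IsIso p := isIso_proj_map_fst U.2 X.obj
  -- Dually, a fibrant replacement of `F (X ⨯ U)` is chosen in `N`, with `r` a trivial cofibration
  -- so that the given map to the fibrant `R` extends along its image.
  obtain ⟨Z, r, q, -, hr, hq⟩ := MorphismProperty.factorizationData (trivialCofibrations N)
    (fibrations N) (terminal.from (F.obj (X.obj ⨯ U.1)))
  have hZ : IsFibrant Z := ⟨by rwa [Subsingleton.elim (terminal.from Z) q]⟩
  let r' : (inducedFunctor F hF hF').obj ((proj Φ).obj (X.obj ⨯ U.1)) ⟶ (proj Ψ).obj Z :=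
    (proj Ψ).map r
  have hr' : trivialCofibrations (FilterQuotient Ψ) r' := by
    rw [trivialCofibrations_filterQuotient]
    exact quotientClass_proj_map (stableUnderProd_trivialCofibrations Ψ) hr
  have := (isModelStructure_filterQuotient Ψ).lifting_trivialCofibration r' (terminal.from R)
    hr' hR.mem
  let sq : CommSq ((inducedFunctor F hF hF').map p ≫ j) r' (terminal.from R)
    (terminal.from ((proj Ψ).obj Z)) := ⟨Subsingleton.elim _ _⟩
  have hl : weakEquivalences _ sq.lift := by
    refine (weakEquivalences _).of_precomp _ _ hr'.2 ?_
    rw [sq.fac_left]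
    exact (MorphismProperty.cancel_left_of_respectsIso
      (weakEquivalences (FilterQuotient Ψ)) _ _).2 hj
  have hGl : weakEquivalences _ ((inducedFunctor G hG hG').map sq.lift) :=
    quotientClass_inducedFunctor_map hG hG'
      (fun f hf ↦ h.weakEquivalences_map_of_isFibrant f hf.1 hf.2.1 hf.2.2)
      (quotientClass_of_isFibrant (isFibrant_proj hZ) hR hl)
  have hc : weakEquivalences _ ((inducedAdjunction adj hF hF' hG hG').unit.app
      ((proj Φ).obj (X.obj ⨯ U.1)) ≫ (inducedFunctor G hG hG').map r') := by
    have e := weakEquivalences_proj_map Φ (h' _ _ r hXU hZ hr.2)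
    rw [Functor.map_comp, ← inducedFunctor_map_proj_map G hG hG'] at e
    exact e
  refine (MorphismProperty.cancel_left_of_respectsIso
    (weakEquivalences (FilterQuotient Φ)) p _).1 ?_
  -- Up to the isomorphism `p`, the derived unit for `j` is the one for the reference replacement
  -- followed by `G` of the comparison map.
  have e : p ≫ (inducedAdjunction adj hF hF' hG hG').unit.app X ≫
      (inducedFunctor G hG hG').map j =
      ((inducedAdjunction adj hF hF' hG hG').unit.app ((proj Φ).obj (X.obj ⨯ U.1)) ≫
        (inducedFunctor G hG hG').map r') ≫ (inducedFunctor G hG hG').map sq.lift := by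
    have nat : p ≫ (inducedAdjunction adj hF hF' hG hG').unit.app X =
        (inducedAdjunction adj hF hF' hG hG').unit.app ((proj Φ).obj (X.obj ⨯ U.1)) ≫
          (inducedFunctor G hG hG').map ((inducedFunctor F hF hF').map p) :=
      (inducedAdjunction adj hF hF' hG hG').unit.naturality p
    rw [Category.assoc, ← Functor.map_comp, sq.fac_left, Functor.map_comp]
    refine (Category.assoc _ _ _).symm.trans ?_
    exact (congrArg (· ≫ (inducedFunctor G hG hG').map j) nat).trans (Category.assoc _ _ _)
  rw [e]
  exact (weakEquivalences _).comp_mem _ _ hc hGl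

end Induced

end FilterQuotients

end

theorem mainTheorem7 {M : Type u₁} [Category.{v₁} M] [ModelCategory M]
    {N : Type u₂} [Category.{v₂} N] [ModelCategory N]
    (ΦM : ObjectProperty M) [IsModelFilter ΦM] (ΦN : ObjectProperty N) [IsModelFilter ΦN]
    {F : M ⥤ N} {G : N ⥤ M} (adj : F ⊣ G) (hadj : IsQuillenAdjunction adj)
    (hprod : ∀ X U : M, ΦM U → IsIso (prodComparison F X U))
    (hF : ∀ U : M, ΦM U → ΦN (F.obj U)) (hG : ∀ V : N, ΦN V → ΦM (G.obj V)) :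
    IsModelStructure (FilterQuotient ΦM) ∧ IsModelStructure (FilterQuotient ΦN) ∧
    ∃ adj' : (inducedFunctor F hF hprod : FilterQuotient ΦM ⥤ FilterQuotient ΦN) ⊣
        inducedFunctor G hG (fun Y V _ ↦ isIso_prodComparison_of_adjunction adj Y V),
      (∀ X : M, adj'.unit.app ((FilterQuotient.proj ΦM).obj X) =
        (FilterQuotient.proj ΦM).map (adj.unit.app X)) ∧
      (∀ Y : N, adj'.counit.app ((FilterQuotient.proj ΦN).obj Y) =
        (FilterQuotient.proj ΦN).map (adj.counit.app Y)) ∧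
      IsQuillenAdjunction adj' ∧
      (IsHomotopicalLocalization adj → IsHomotopicalLocalization adj') ∧
      (IsHomotopicalColocalization adj → IsHomotopicalColocalization adj') ∧
      (IsQuillenEquivalence adj → IsQuillenEquivalence adj') := by
  have hG' : ∀ Y V : N, ΦN V → IsIso (prodComparison G Y V) :=
    fun Y V _ ↦ isIso_prodComparison_of_adjunction adj Y V
  have hquillen := isQuillenAdjunction_inducedAdjunction hF hprod hG hG' hadj
  have hloc : IsHomotopicalLocalization adj →
      IsHomotopicalLocalization (inducedAdjunction adj hF hprod hG hG') :=
    fun h ↦ ⟨hquillen, derivedCounitIsEquivalence_inducedAdjunction hF hprod hG hG' hadj h.2⟩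
  have hcoloc : IsHomotopicalColocalization adj →
      IsHomotopicalColocalization (inducedAdjunction adj hF hprod hG hG') :=
    fun h ↦ ⟨hquillen, derivedUnitIsEquivalence_inducedAdjunction hF hprod hG hG' hadj h.2⟩
  refine ⟨isModelStructure_filterQuotient ΦM, isModelStructure_filterQuotient ΦN,
    inducedAdjunction adj hF hprod hG hG', fun _ ↦ rfl, fun _ ↦ rfl, hquillen, hloc, hcoloc, ?_⟩
  rw [isQuillenEquivalence_iff, isQuillenEquivalence_iff]
  exact fun h ↦ ⟨hloc h.1, hcoloc h.2⟩
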